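/- **Setting.** All manifolds are smooth, non-empty, Hausdorff, second countable, and of one finite dimension; $\mathcal Mf$ is the category of manifolds and smooth maps, $pt$ is the one-point manifold. Let $\Lambda$ be a finite partially ordered set. *Multifibered manifolds.* For a map $p:\{1,\dots,n\}\to\Lambda$ put $H_\alpha=\{i: p(i)\le\alpha\}$. An object of $\mathcal{FM}_\Lambda$ is a projective system $\pi=(M_\alpha,\pi^\beta_\alpha,\Lambda,M)$ in which the $M_\alpha$ ($\alpha\in\Lambda$) and $M=\varprojlim M_\alpha$ are manifolds, the maps $\pi^\beta_\alpha:M_\beta\to M_\alpha$ ($\alpha\le\beta$) and $\pi_\alpha:M\to M_\alpha$ are surjective submersions, and for some $n$ and $p:\{1,\dots,n\}\to\Lambda$ every point $x=(x_\alpha)$ of $M$ admits charts of $M$ centered at $x$ and of the $M_\alpha$ centered at $x_\alpha$ in which each $\pi_\alpha$ becomes the coordinate projection $\mathbb R^n\to\mathbb R^{H_\alpha}$. A morphism $f:\pi\to\overline\pi$ is a family of smooth maps $f_\alpha:M_\alpha\to\overline M_\alpha$ commuting with the projections; it induces a smooth map $f:M\to\overline M$ of the limits. *Bundle functors.* A bundle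 functor on $\mathcal Mf$ (respectively $\mathcal{FM}_\Lambda$) is a functor $F$ with values in manifolds together with surjective submersions $F(X)\to X$ (respectively $F(\pi)\to M$), natural in $X$ (respectively $\pi$), which is local: if $f$ is a diffeomorphism onto an open submanifold (respectively, if every $f_\alpha$ is), then $F(f)$ is a diffeomorphism onto the restriction of the target bundle to the open image of $f$. It is product preserving if it carries binary products to products. Natural transformations cover the identity of the base. Two bundle functors are equivalent if there is a natural equivalence between them. *Inductive systems.* An inductive system $\mu$ over $\Lambda$ consists of product preserving bundle functors $G_\alpha$ on $\mathcal Mf$ ($\alpha\in\Lambda$) and natural transformations $\mu^\alpha_\beta:G_\alpha\to G_\beta$ ($\alpha\le\beta$) with $\mu^\alpha_\alpha=\mathrm{id}$ and $\mu^\beta_\gamma\circ\mu^\alpha_\beta=\mu^\alpha_\gamma$. Two systems $\mu,\overline\mu$ are equivalent if there are natural equivalences $\nu_\alpha:G_\alpha\to\overline G_\alpha$ with $\overline\mu^\alpha_\beta\circ\nu_\alpha=\nu_\beta\circ\mu^\alpha_\beta$ for all $\alpha\le\beta$. *The system $\mu^F$.* For a manifold $X$ let $i_\alpha(X)$ be the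 multifibered manifold with $X_\gamma=X$ if $\gamma\ge\alpha$ and $X_\gamma=pt$ otherwise, with the projections $\mathrm{id}_X$ or the maps to $pt$; its limit is $X$. This defines functors $i_\alpha:\mathcal Mf\to\mathcal{FM}_\Lambda$, and the maps $\mathrm{id}_X$ define natural transformations $\mathrm{id}^\alpha_\beta:i_\alpha\to i_\beta$ for $\alpha\le\beta$. For a product preserving bundle functor $F$ on $\mathcal{FM}_\Lambda$, $\mu^F$ is the inductive system with $G^F_\alpha=F\circ i_\alpha$ and $(\mu^F)^\alpha_\beta=F(\mathrm{id}^\alpha_\beta)$. *The functor $T^\mu$.* For an inductive system $\mu$, $T^\mu$ is the product preserving bundle functor on $\mathcal{FM}_\Lambda$, determined up to a unique compatible natural equivalence, for which $T^\mu(\pi)$ is identified with the embedded submanifold $$\Big\{(x_\alpha)\in\prod_{\alpha\in\Lambda}G_\alpha(M_\alpha)\ \Big|\ G_\beta(\pi^\beta_\alpha)(x_\beta)=\mu^\alpha_\beta(M_\alpha)(x_\alpha)\ \text{for all }\alpha\le\beta\Big\},$$ its projection to $M\subset\prod_\alpha M_\alpha$ is the restriction of the product of the projections $G_\alpha(M_\alpha)\to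 M_\alpha$, and $T^\mu(f)$ is the restriction of $\prod_\alpha G_\alpha(f_\alpha)$. **Proposition 3.4.** The correspondence $F\mapsto\mu^F$ induces a bijection between the equivalence classes of product preserving bundle functors on $\mathcal{FM}_\Lambda$ and the equivalence classes of inductive systems over $\Lambda$ of natural transformations between product preserving bundle functors on $\mathcal Mf$. For every inductive system $\mu$ the functor $T^\mu$ exists, and the inverse bijection is induced by $\mu\mapsto T^\mu$. -/

import Mathlib

open CategoryTheory CategoryTheory.Limits
open scoped Manifold ContDiff

noncomputable section

/-- A smooth manifold: non-empty, Hausdorff, second countable, without boundary, modelled on one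
finite-dimensional real vector space (so all components have the same dimension). -/
structure Mfd : Type 1 where
  carrier : Type
  model : Type
  [normed : NormedAddCommGroup model]
  [normedSpace : NormedSpace ℝ model]
  [finite : FiniteDimensional ℝ model]
  [top : TopologicalSpace carrier]
  [charted : ChartedSpace model carrier]
  [smooth : IsManifold 𝓘(ℝ, model) ∞ carrier]
  [t2 : T2Space carrier]
  [secondCountable : SecondCountableTopology carrier]
  [nonempty : Nonempty carrier]

namespace Mfd

attribute [instance] Mfd.normed Mfd.normedSpace Mfd.finite Mfd.top Mfd.charted Mfd.smooth Mfd.t2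
  Mfd.secondCountable Mfd.nonempty

instance : CoeSort Mfd Type := ⟨Mfd.carrier⟩

/-- A smooth map. -/
@[ext]
structure Hom (M N : Mfd) where
  toFun : M → N
  contMDiff : ContMDiff 𝓘(ℝ, M.model) 𝓘(ℝ, N.model) ∞ toFun

/-- The category of smooth manifolds and smooth maps. -/
instance : Category Mfd where
  Hom := Hom
  id M := ⟨id, contMDiff_id⟩
  comp f g := ⟨g.toFun ∘ f.toFun, g.contMDiff.comp f.contMDiff⟩

@[ext]
theorem hom_ext {M N : Mfd} {f g : M ⟶ N} (h : ∀ x, f.toFun x = g.toFun x) : f = g :=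
  Hom.ext (funext h)

@[simp] theorem id_toFun (M : Mfd) (x : M) : Hom.toFun (𝟙 M) x = x := rfl

@[simp] theorem comp_toFun {M N P : Mfd} (f : M ⟶ N) (g : N ⟶ P) (x : M) :
    Hom.toFun (f ≫ g) x = g.toFun (f.toFun x) := rfl

/-- The one-point manifold. -/
def pt : Mfd where
  carrier := PUnit
  model := PUnit

/-- The unique map to the one-point manifold. -/
def toPt (M : Mfd) : M ⟶ pt := ⟨fun _ => PUnit.unit, contMDiff_const⟩

theorem toPt_unique {M : Mfd} (f g : M ⟶ pt) : f = g := by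
  ext x
  exact Subsingleton.elim (α := PUnit) _ _

/-- Surjective submersions, i.e. fibered manifolds `f : M → N`. -/
def IsSurjSubmersion {M N : Mfd} (f : M ⟶ N) : Prop :=
  Function.Surjective f.toFun ∧
    ∀ x, Function.Surjective (mfderiv 𝓘(ℝ, M.model) 𝓘(ℝ, N.model) f.toFun x)

/-- Diffeomorphisms onto an open submanifold. -/
def IsOpenEmb {M N : Mfd} (f : M ⟶ N) : Prop :=
  Function.Injective f.toFun ∧
    IsLocalDiffeomorph 𝓘(ℝ, M.model) 𝓘(ℝ, N.model) ∞ f.toFun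

/-- The morphism property of being a diffeomorphism onto an open submanifold. -/
def openEmb : MorphismProperty Mfd := fun _ _ f => IsOpenEmb f

end Mfd

/-! ### Bundle functors -/

section BundleFunctor

universe v u

variable {C : Type u} [Category.{v} C]

/-- A bundle functor on a category over manifolds `m : C ⥤ Mfd`, where `inc` is the class of
inclusions of open subobjects in `C`. It is a functor `F` to fibered manifolds with base functor
`m`: `total` gives the total spaces and `proj` the bundle projections `p_c : F c → m c`.
Locality: for an open inclusion `i : c → d`, the map `F i` is a diffeomorphism of `F c` onto the
restriction of `F d` to the open set `m c ⊆ m d`. -/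
structure BundleFunctor (m : C ⥤ Mfd) (inc : MorphismProperty C) where
  total : C ⥤ Mfd
  proj : total ⟶ m
  fibered : ∀ c, Mfd.IsSurjSubmersion (proj.app c)
  locality : ∀ {c d : C} (i : c ⟶ d), inc i → Mfd.IsOpenEmb (total.map i) ∧
    Set.range (total.map i).toFun = (proj.app d).toFun ⁻¹' Set.range (m.map i).toFun

variable {m : C ⥤ Mfd} {inc : MorphismProperty C}

/-- A natural transformation of bundle functors: a natural family of smooth maps `F c → G c`
over the identity of `m c`. -/
@[ext]
structure BundleFunctor.Hom (F G : BundleFunctor m inc) where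
  trans : F.total ⟶ G.total
  comp_proj : trans ≫ G.proj = F.proj

variable (m inc) in
/-- A product preserving bundle functor. -/
structure PPBundleFunctor extends BundleFunctor m inc where
  preservesProducts : PreservesLimitsOfShape (Discrete WalkingPair) total

/-- Product preserving bundle functors and their natural transformations. -/
instance : Category (PPBundleFunctor m inc) where
  Hom F G := BundleFunctor.Hom F.toBundleFunctor G.toBundleFunctor
  id F := { trans := 𝟙 F.total, comp_proj := Category.id_comp _ }
  comp a b :=
    { trans := BundleFunctor.Hom.trans a ≫ BundleFunctor.Hom.trans b
      comp_proj := by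
        rw [Category.assoc, BundleFunctor.Hom.comp_proj b, BundleFunctor.Hom.comp_proj a] }

end BundleFunctor

/-! ### Multifibered manifolds -/

universe u

open Classical in
/-- A multifibered manifold over `Λ`: a projective system of manifolds `M_α` with surjective
submersions `π^β_α`, whose projective limit `M` (of sets) is a manifold with surjective
submersions `π_α : M → M_α`, and which is locally a multifoliate projective system of vector spaces:
there is `p : {1,…,n} → Λ` such that near every point there are centered charts in which `π_α` is
the restriction of coordinates `ℝ^n → ℝ^{H_α}`, `H_α = {i | p i ≤ α}`. -/
structure MultifiberedMfd (Λ : Type u) [PartialOrder Λ] where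
  stage : Λ → Mfd
  res : ∀ {α β : Λ}, α ≤ β → (stage β ⟶ stage α)
  res_refl : ∀ α, res (le_refl α) = 𝟙 (stage α)
  res_comp : ∀ {α β γ : Λ} (h : α ≤ β) (h' : β ≤ γ), res h' ≫ res h = res (h.trans h')
  res_submersion : ∀ {α β : Λ} (h : α ≤ β), Mfd.IsSurjSubmersion (res h)
  total : Mfd
  proj : ∀ α, total ⟶ stage α
  proj_res : ∀ {α β : Λ} (h : α ≤ β), proj β ≫ res h = proj α
  proj_submersion : ∀ α, Mfd.IsSurjSubmersion (proj α)
  isLimit : ∀ x : ∀ α, stage α, (∀ {α β : Λ} (h : α ≤ β), (res h).toFun (x β) = x α) →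
    ∃! y : total, ∀ α, (proj α).toFun y = x α
  adapted : ∃ (n : ℕ) (p : Fin n → Λ), ∀ x : total,
    ∃ (h : PartialDiffeomorph 𝓘(ℝ, total.model) 𝓘(ℝ, Fin n → ℝ) total (Fin n → ℝ) ∞)
      (k : ∀ α, PartialDiffeomorph 𝓘(ℝ, (stage α).model) 𝓘(ℝ, {i // p i ≤ α} → ℝ)
        (stage α) ({i // p i ≤ α} → ℝ) ∞),
      x ∈ h.source ∧ h x = 0 ∧
      ∀ α, Set.MapsTo (proj α).toFun h.source (k α).source ∧
        ∀ y ∈ h.source, ∀ i, k α ((proj α).toFun y) i = h y i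

namespace MultifiberedMfd

variable {Λ : Type u} [PartialOrder Λ]

/-- A multifibered map: a family of smooth maps `f_α : M_α → N_α` commuting with the projections,
recorded together with the smooth map `f : M → N` of the limits that it determines. -/
structure Hom (π π' : MultifiberedMfd Λ) where
  app : ∀ α, π.stage α ⟶ π'.stage α
  total : π.total ⟶ π'.total
  app_res : ∀ {α β : Λ} (h : α ≤ β), π.res h ≫ app α = app β ≫ π'.res h
  total_proj : ∀ α, total ≫ π'.proj α = π.proj α ≫ app α

/-- Points of the limit are determined by their projections. -/
theorem point_ext (π : MultifiberedMfd Λ) {y z : π.total}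
    (h : ∀ α, (π.proj α).toFun y = (π.proj α).toFun z) : y = z := by
  obtain ⟨w, -, hw⟩ := π.isLimit (fun α => (π.proj α).toFun z)
    (fun h => congrArg (fun f => Mfd.Hom.toFun f z) (π.proj_res h))
  exact (hw y h).trans (hw z fun _ => rfl).symm

/-- A multifibered map is determined by the family `f_α`. -/
theorem Hom.ext' {π π' : MultifiberedMfd Λ} {f g : Hom π π'} (h : ∀ α, f.app α = g.app α) :
    f = g := by
  have ht : f.total = g.total := by
    ext x
    refine π'.point_ext fun α => ?_
    have h1 := congrArg (fun k => Mfd.Hom.toFun k x) (f.total_proj α)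
    have h2 := congrArg (fun k => Mfd.Hom.toFun k x) (g.total_proj α)
    rw [← h α] at h2
    exact h1.trans h2.symm
  cases f; cases g
  obtain rfl := funext h
  obtain rfl := ht
  rfl

/-- The category of multifibered manifolds over `Λ`. -/
instance : Category (MultifiberedMfd Λ) where
  Hom := Hom
  id π := ⟨fun _ => 𝟙 _, 𝟙 _, fun _ => by simp, fun _ => by simp⟩
  comp f g :=
    { app := fun α => f.app α ≫ g.app α
      total := f.total ≫ g.total
      app_res := fun h => by
        rw [← Category.assoc, f.app_res, Category.assoc, g.app_res, Category.assoc]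
      total_proj := fun α => by
        rw [Category.assoc, g.total_proj, ← Category.assoc, f.total_proj, Category.assoc] }

@[ext]
theorem hom_ext {π π' : MultifiberedMfd Λ} {f g : π ⟶ π'} (h : ∀ α, f.app α = g.app α) :
    f = g := Hom.ext' h

@[simp] theorem id_app (π : MultifiberedMfd Λ) (α : Λ) : Hom.app (𝟙 π) α = 𝟙 _ := rfl

@[simp] theorem comp_app {π π' π'' : MultifiberedMfd Λ} (f : π ⟶ π') (g : π' ⟶ π'') (α : Λ) :
    Hom.app (f ≫ g) α = f.app α ≫ g.app α := rfl

variable (Λ) in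
/-- The base functor, sending a multifibered manifold to the limit manifold `M`. -/
abbrev base : MultifiberedMfd Λ ⥤ Mfd where
  obj π := π.total
  map f := f.total

/-- The functor sending a multifibered manifold to `M_α`. -/
abbrev eval (α : Λ) : MultifiberedMfd Λ ⥤ Mfd where
  obj π := π.stage α
  map f := f.app α

/-- Inclusions of open multifibered submanifolds: all `f_α` are diffeomorphisms onto open
submanifolds. -/
def openInc : MorphismProperty (MultifiberedMfd Λ) := fun _ _ f => ∀ α, Mfd.IsOpenEmb (f.app α)

/-! ### The multifibered manifolds `i_α(X)` -/

open Classical in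
/-- The manifold `X_γ` of `i_α(X)`: it is `X` if `α ≤ γ` and a point otherwise. -/
def inclStage (α γ : Λ) (X : Mfd) : Mfd := if α ≤ γ then X else Mfd.pt

theorem inclStage_pos {α γ : Λ} (h : α ≤ γ) (X : Mfd) : inclStage α γ X = X := if_pos h

theorem inclStage_neg {α γ : Λ} (h : ¬ α ≤ γ) (X : Mfd) : inclStage α γ X = Mfd.pt := if_neg h

/-- The identification of `X_γ` with `X` for `α ≤ γ`. -/
def fromStage {α γ : Λ} (h : α ≤ γ) (X : Mfd) : inclStage α γ X ⟶ X :=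
  eqToHom (inclStage_pos h X)

open Classical in
/-- A map into `X_γ` is a map into `X` if `α ≤ γ`, and the unique map to the point otherwise. -/
def toStage {α γ : Λ} {N X : Mfd} (f : α ≤ γ → (N ⟶ X)) : N ⟶ inclStage α γ X :=
  if h : α ≤ γ then f h ≫ eqToHom (inclStage_pos h X).symm
  else Mfd.toPt N ≫ eqToHom (inclStage_neg h X).symm

@[simp]
theorem toStage_fromStage {α γ : Λ} {N X : Mfd} (f : α ≤ γ → (N ⟶ X)) (h : α ≤ γ) :
    toStage f ≫ fromStage h X = f h := by
  simp [toStage, fromStage, h]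

@[simp]
theorem toStage_fromStage_assoc {α γ : Λ} {N X Y : Mfd} (f : α ≤ γ → (N ⟶ X)) (h : α ≤ γ)
    (g : X ⟶ Y) : toStage f ≫ fromStage h X ≫ g = f h ≫ g := by
  rw [← Category.assoc, toStage_fromStage]

theorem stage_ext {α γ : Λ} {N X : Mfd} {f g : N ⟶ inclStage α γ X}
    (hfg : ∀ h : α ≤ γ, f ≫ fromStage h X = g ≫ fromStage h X) : f = g := by
  by_cases h : α ≤ γ
  · exact (cancel_mono (eqToHom (inclStage_pos h X))).1 (hfg h)
  · have e : inclStage α γ X = Mfd.pt := inclStage_neg h X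
    rw [← cancel_mono (eqToHom e)]
    exact Mfd.toPt_unique _ _

theorem isSurjSubmersion_id (M : Mfd) : Mfd.IsSurjSubmersion (𝟙 M) := by
  refine ⟨fun x => ⟨x, rfl⟩, fun x => ?_⟩
  have : mfderiv 𝓘(ℝ, M.model) 𝓘(ℝ, M.model) (Mfd.Hom.toFun (𝟙 M)) x
      = ContinuousLinearMap.id ℝ (TangentSpace 𝓘(ℝ, M.model) x) := mfderiv_id
  rw [this]
  exact fun v => ⟨v, rfl⟩

theorem isSurjSubmersion_toPt (M : Mfd) : Mfd.IsSurjSubmersion (Mfd.toPt M) :=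
  ⟨fun _ => ⟨Classical.arbitrary _, Subsingleton.elim (α := PUnit) _ _⟩,
    fun _ _ => ⟨0, Subsingleton.elim (α := PUnit) _ _⟩⟩

theorem isSurjSubmersion_toStage {α γ : Λ} {N X : Mfd} (f : α ≤ γ → (N ⟶ X))
    (hf : ∀ h, Mfd.IsSurjSubmersion (f h)) : Mfd.IsSurjSubmersion (toStage (γ := γ) f) := by
  have key : ∀ {M P : Mfd} (e : M = P) (g : N ⟶ M), Mfd.IsSurjSubmersion g →
      Mfd.IsSurjSubmersion (g ≫ eqToHom e) := by
    rintro M _ rfl g hg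
    simpa using hg
  by_cases h : α ≤ γ
  · simp only [toStage, dif_pos h]
    exact key (inclStage_pos h X).symm _ (hf h)
  · simp only [toStage, dif_neg h]
    exact key (inclStage_neg h X).symm _ (isSurjSubmersion_toPt N)

theorem isSurjSubmersion_fromStage {α γ : Λ} (h : α ≤ γ) (X : Mfd) :
    Mfd.IsSurjSubmersion (fromStage h X) := by
  have key : ∀ {M P : Mfd} (e : M = P), Mfd.IsSurjSubmersion (eqToHom e) := by
    rintro M _ rfl
    exact isSurjSubmersion_id M
  exact key _

/-- A chart of `X` centered at `x`, with values in a vector space isomorphic to the model. -/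
def centeredChart (X : Mfd) (x : X) {V : Type} [NormedAddCommGroup V] [NormedSpace ℝ V]
    (e : X.model ≃L[ℝ] V) : PartialDiffeomorph 𝓘(ℝ, X.model) 𝓘(ℝ, V) X V ∞ where
  toFun y := e (chartAt X.model x y - chartAt X.model x x)
  invFun v := (chartAt X.model x).symm (e.symm v + chartAt X.model x x)
  source := (chartAt X.model x).source
  target := (fun v => e.symm v + chartAt X.model x x) ⁻¹' (chartAt X.model x).target
  map_source' y hy := by simp [hy]
  map_target' v hv := (chartAt X.model x).map_target hv
  left_inv' y hy := by simp [hy]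
  right_inv' v hv := by
    have := (chartAt X.model x).right_inv hv
    simp [this]
  open_source := (chartAt X.model x).open_source
  open_target := (chartAt X.model x).open_target.preimage (by fun_prop)
  contMDiffOn_toFun := by
    have h1 : ContDiff ℝ ∞ (fun z : X.model => e (z - chartAt X.model x x)) := by fun_prop
    exact h1.contMDiff.comp_contMDiffOn (contMDiffOn_chart (I := 𝓘(ℝ, X.model)))
  contMDiffOn_invFun := by
    have h1 : ContDiff ℝ ∞ (fun v : V => e.symm v + chartAt X.model x x) := by fun_prop
    exact (contMDiffOn_chart_symm (I := 𝓘(ℝ, X.model))).comp h1.contMDiff.contMDiffOn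
      (fun _ hv => hv)

open Classical in
theorem incl_adapted (α : Λ) (X : Mfd) : ∃ (n : ℕ) (p : Fin n → Λ), ∀ x : X,
    ∃ (h : PartialDiffeomorph 𝓘(ℝ, X.model) 𝓘(ℝ, Fin n → ℝ) X (Fin n → ℝ) ∞)
      (k : ∀ γ, PartialDiffeomorph 𝓘(ℝ, (inclStage α γ X).model) 𝓘(ℝ, {i // p i ≤ γ} → ℝ)
        (inclStage α γ X) ({i // p i ≤ γ} → ℝ) ∞),
      x ∈ h.source ∧ h x = 0 ∧
      ∀ γ, Set.MapsTo (toStage (α := α) (γ := γ) (fun _ => 𝟙 X)).toFun h.source (k γ).source ∧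
        ∀ y ∈ h.source, ∀ i,
          k γ ((toStage (α := α) (γ := γ) (fun _ => 𝟙 X)).toFun y) i = h y i := by
  refine ⟨Module.finrank ℝ X.model, fun _ => α, fun x => ?_⟩
  let e : X.model ≃L[ℝ] (Fin (Module.finrank ℝ X.model) → ℝ) :=
    ContinuousLinearEquiv.ofFinrankEq (by simp)
  have hk : ∀ γ, ∃ k : PartialDiffeomorph 𝓘(ℝ, (inclStage α γ X).model)
      𝓘(ℝ, {i : Fin (Module.finrank ℝ X.model) // α ≤ γ} → ℝ) (inclStage α γ X)
      ({i : Fin (Module.finrank ℝ X.model) // α ≤ γ} → ℝ) ∞,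
      Set.MapsTo (toStage (α := α) (γ := γ) (fun _ => 𝟙 X)).toFun
        (centeredChart X x e).source k.source ∧ ∀ y ∈ (centeredChart X x e).source, ∀ i,
          k ((toStage (α := α) (γ := γ) (fun _ => 𝟙 X)).toFun y) i = centeredChart X x e y i := by
    intro γ
    by_cases h : α ≤ γ
    · have key : ∀ (S : Mfd) (q : X = S), ∃ k : PartialDiffeomorph 𝓘(ℝ, S.model)
          𝓘(ℝ, {i : Fin (Module.finrank ℝ X.model) // α ≤ γ} → ℝ) S
          ({i : Fin (Module.finrank ℝ X.model) // α ≤ γ} → ℝ) ∞,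
          Set.MapsTo (Mfd.Hom.toFun (eqToHom q)) (centeredChart X x e).source k.source ∧
          ∀ y ∈ (centeredChart X x e).source, ∀ i,
            k (Mfd.Hom.toFun (eqToHom q) y) i = centeredChart X x e y i := by
        rintro _ rfl
        exact ⟨centeredChart X x (e.trans (LinearEquiv.funCongrLeft ℝ ℝ
          (Equiv.subtypeUnivEquiv fun _ => h)).toContinuousLinearEquiv),
          fun y hy => hy, fun y _ i => rfl⟩
      have := key (inclStage α γ X) (inclStage_pos h X).symm
      simpa [toStage, h] using this
    · have key : ∀ (S : Mfd) (q : Mfd.pt = S), ∃ k : PartialDiffeomorph 𝓘(ℝ, S.model)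
          𝓘(ℝ, {i : Fin (Module.finrank ℝ X.model) // α ≤ γ} → ℝ) S
          ({i : Fin (Module.finrank ℝ X.model) // α ≤ γ} → ℝ) ∞, k.source = Set.univ := by
        have hE : IsEmpty {i : Fin (Module.finrank ℝ X.model) // α ≤ γ} := ⟨fun i => h i.2⟩
        rintro _ rfl
        exact ⟨{  toFun := fun _ => 0
                  invFun := fun _ => PUnit.unit
                  source := Set.univ
                  target := Set.univ
                  map_source' := fun _ _ => trivial
                  map_target' := fun _ _ => trivial
                  left_inv' := fun _ _ => rfl
                  right_inv' := fun _ _ => Subsingleton.elim _ _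
                  open_source := isOpen_univ
                  open_target := isOpen_univ
                  contMDiffOn_toFun := contMDiffOn_const
                  contMDiffOn_invFun := contMDiffOn_const }, rfl⟩
      obtain ⟨k, hk⟩ := key (inclStage α γ X) (inclStage_neg h X).symm
      exact ⟨k, fun y _ => hk ▸ Set.mem_univ _, fun y _ i => (h i.2).elim⟩
  choose k hk using hk
  exact ⟨centeredChart X x e, k, mem_chart_source _ x, by
    change e (chartAt X.model x x - chartAt X.model x x) = 0
    simp, hk⟩

/-- The multifibered manifold `i_α(X)`: `X_γ = X` for `γ ≥ α` and `X_γ = pt` otherwise, with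
projections the identity of `X` or the maps to the point; its limit is `X`. -/
abbrev inclObj (α : Λ) (X : Mfd) : MultifiberedMfd Λ where
  stage γ := inclStage α γ X
  res h := toStage fun hδ => fromStage (hδ.trans h) X
  res_refl γ := stage_ext fun h => by simp
  res_comp h h' := stage_ext fun hα => by simp
  res_submersion h := isSurjSubmersion_toStage _ fun _ => isSurjSubmersion_fromStage _ X
  total := X
  proj γ := toStage fun _ => 𝟙 X
  proj_res h := stage_ext fun hα => by simp
  proj_submersion γ := isSurjSubmersion_toStage _ fun _ => isSurjSubmersion_id X
  isLimit x hx := by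
    refine ⟨(fromStage (le_refl α) X).toFun (x α), fun γ => ?_, fun y hy => ?_⟩
    · by_cases h : α ≤ γ
      · have e : (toStage (γ := α) (fun hδ => fromStage (hδ.trans h) X)) ≫
            fromStage (le_refl α) X ≫ toStage (γ := γ) (fun _ => 𝟙 X) = 𝟙 _ :=
          stage_ext fun _ => by simp
        rw [← hx h]
        exact congrArg (fun f => Mfd.Hom.toFun f (x γ)) e
      · have : Subsingleton (inclStage α γ X).carrier := by
          rw [inclStage, if_neg h]
          exact inferInstanceAs (Subsingleton PUnit)
        exact Subsingleton.elim _ _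
    · rw [← hy α]
      exact (congrArg (fun f => Mfd.Hom.toFun f y)
        (toStage_fromStage (fun _ : α ≤ α => 𝟙 X) (le_refl α))).symm
  adapted := incl_adapted α X

/-- The functor `i_α`. -/
abbrev incl (α : Λ) : Mfd ⥤ MultifiberedMfd Λ where
  obj X := inclObj α X
  map {X Y} f :=
    { app := fun γ => toStage fun h => fromStage h X ≫ f
      total := f
      app_res := fun h => stage_ext fun hα => by simp [inclObj]
      total_proj := fun γ => stage_ext fun hα => by simp [inclObj] }
  map_id X := by
    ext1 γ
    exact stage_ext fun h => by simp [inclObj]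
  map_comp f g := by
    ext1 γ
    exact stage_ext fun h => by simp

/-- The natural transformations `i_α ⟶ i_β`, `α ≤ β`, consisting of the maps `id_X`. -/
abbrev inclTrans {α β : Λ} (hαβ : α ≤ β) : (incl α : Mfd ⥤ MultifiberedMfd Λ) ⟶ incl β where
  app X :=
    { app := fun γ => toStage fun h => fromStage (hαβ.trans h) X
      total := 𝟙 X
      app_res := fun h => stage_ext fun hα => by simp [incl, inclObj]
      total_proj := fun γ => stage_ext fun hα => by simp [incl, inclObj] }
  naturality X Y f := by
    ext1 γ
    exact stage_ext fun h => by simp [incl]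

theorem inclTrans_refl (α : Λ) (X : Mfd) : (inclTrans (le_refl α)).app X = 𝟙 _ := by
  ext1 γ
  exact stage_ext fun h => by simp [incl, inclObj]

theorem inclTrans_comp {α β γ : Λ} (h : α ≤ β) (h' : β ≤ γ) (X : Mfd) :
    (inclTrans (h.trans h')).app X = (inclTrans h).app X ≫ (inclTrans h').app X := by
  ext1 δ
  exact stage_ext fun h => by simp [incl, inclObj]

/-- Multifibered maps `π → i_α(X)` are the same as maps `M_α → X`. -/
def inclHomEquiv (α : Λ) (π : MultifiberedMfd Λ) (X : Mfd) :
    (π.stage α ⟶ X) ≃ (π ⟶ (incl α).obj X) where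
  toFun f :=
    { app := fun γ => toStage fun h => π.res h ≫ f
      total := π.proj α ≫ f
      app_res := fun {γ δ} h => stage_ext fun hα => by
        simp [incl, inclObj, ← π.res_comp hα h]
      total_proj := fun γ => stage_ext fun hα => by
        simp [incl, inclObj, ← π.proj_res hα] }
  invFun g := g.app α ≫ fromStage (le_refl α) X
  left_inv f := (toStage_fromStage _ _).trans (by rw [π.res_refl, Category.id_comp])
  right_inv g := by
    ext1 γ
    refine stage_ext fun h => (toStage_fromStage _ h).trans ?_
    change π.res h ≫ g.app α ≫ fromStage (le_refl α) X = g.app γ ≫ fromStage h X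
    rw [← Category.assoc, g.app_res h]
    simp

/-- `i_α` is right adjoint to `π ↦ M_α`; in particular it preserves products. -/
def inclAdj (α : Λ) : eval α ⊣ (incl α : Mfd ⥤ MultifiberedMfd Λ) :=
  Adjunction.mkOfHomEquiv
    { homEquiv := inclHomEquiv α
      homEquiv_naturality_left_symm := fun {_ _ Y} f g =>
        Category.assoc (f.app α) (g.app α) (fromStage (le_refl α) Y)
      homEquiv_naturality_right := fun {π _ _} f g => by
        ext1 γ
        refine stage_ext fun h => ?_
        change toStage (fun h => π.res h ≫ f ≫ g) ≫ fromStage h _ =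
          (toStage (fun h => π.res h ≫ f) ≫ toStage fun h => fromStage h _ ≫ g) ≫ fromStage h _
        simp }

theorem incl_openInc (α : Λ) {X Y : Mfd} (f : X ⟶ Y) (hf : Mfd.openEmb f) :
    openInc ((incl α : Mfd ⥤ MultifiberedMfd Λ).map f) := by
  intro γ
  change Mfd.IsOpenEmb (toStage fun h => fromStage h X ≫ f)
  by_cases h : α ≤ γ
  · have key : ∀ (S T : Mfd) (a : S = X) (b : Y = T),
        Mfd.IsOpenEmb (eqToHom a ≫ f ≫ eqToHom b) := by
      rintro _ _ rfl rfl
      have h1 : Mfd.IsOpenEmb f := hf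
      simpa using h1
    simpa [toStage, fromStage, h] using key (inclStage α γ X) (inclStage α γ Y)
      (inclStage_pos h X) (inclStage_pos h Y).symm
  · have key : ∀ (S T : Mfd) (_ : S = Mfd.pt) (_ : T = Mfd.pt) (g : S ⟶ T),
        Mfd.IsOpenEmb g := by
      rintro _ _ rfl rfl g
      rw [Mfd.toPt_unique g (𝟙 _)]
      exact ⟨fun _ _ h => h, (Diffeomorph.refl _ _ _).isLocalDiffeomorph⟩
    exact key _ _ (inclStage_neg h X) (inclStage_neg h Y) _

end MultifiberedMfd

/-! ### The correspondences -/

open MultifiberedMfd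

/-- Product preserving bundle functors on smooth manifolds. -/
abbrev PPBundleFunctorMf : Type 1 := PPBundleFunctor (𝟭 Mfd) Mfd.openEmb

/-- Product preserving bundle functors on multifibered manifolds over `Λ`. -/
abbrev PPBundleFunctorFM (Λ : Type u) [PartialOrder Λ] : Type (max u 1) :=
  PPBundleFunctor (base Λ) openInc

/-- Inductive systems over `Λ` of natural transformations between product preserving bundle
functors on smooth manifolds: functors from the poset `Λ`. Their isomorphisms are the families of
natural equivalences `ν_α` commuting with the transformations `μ^α_β`. -/
abbrev InductiveSystem (Λ : Type u) [PartialOrder Λ] : Type (max u 1) := Λ ⥤ PPBundleFunctorMf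

/-- The bundle functor `G^F_α = F ∘ i_α`. -/
def compIncl {Λ : Type u} [PartialOrder Λ] (F : PPBundleFunctorFM Λ) (α : Λ) :
    PPBundleFunctorMf where
  total := incl α ⋙ F.total
  proj := { app := fun X => F.proj.app ((incl α).obj X)
            naturality := fun _ _ f => F.proj.naturality ((incl α).map f) }
  fibered _ := F.fibered _
  locality i hi := F.locality _ (incl_openInc α i hi)
  preservesProducts :=
    have := F.preservesProducts
    have := (inclAdj (Λ := Λ) α).rightAdjoint_preservesLimits
    inferInstance

/-- The inductive system `μ^F`, with `(μ^F)^α_β = F(id^α_β) : G^F_α → G^F_β`. -/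
def inductiveSystemOf {Λ : Type u} [PartialOrder Λ] (F : PPBundleFunctorFM Λ) :
    InductiveSystem Λ where
  obj α := compIncl F α
  map h :=
    { trans := Functor.whiskerRight (inclTrans h.le) F.total
      comp_proj := by
        apply NatTrans.ext
        funext X
        exact (F.proj.naturality ((inclTrans h.le).app X)).trans (Category.comp_id _) }
  map_id α := by
    apply BundleFunctor.Hom.ext
    apply NatTrans.ext
    funext X
    exact (congrArg F.total.map (inclTrans_refl α X)).trans (F.total.map_id _)
  map_comp f g := by
    apply BundleFunctor.Hom.ext
    apply NatTrans.ext
    funext X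
    exact (congrArg F.total.map (inclTrans_comp f.le g.le X)).trans (F.total.map_comp _ _)

/-- The subset `∏_μ G_α(π) = {(x_α) | G_β(π^β_α)(x_β) = μ^α_β(M_α)(x_α)}` of
`∏_α G_α(M_α)`. -/
def prodSet {Λ : Type u} [PartialOrder Λ] (μ : InductiveSystem Λ) (π : MultifiberedMfd Λ) :
    Set (∀ α, (μ.obj α).total.obj (π.stage α)) :=
  {x | ∀ (α β : Λ) (h : α ≤ β), ((μ.obj β).total.map (π.res h)).toFun (x β) =
    ((BundleFunctor.Hom.trans (μ.map (homOfLE h))).app (π.stage α)).toFun (x α)}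

/-- `T` is (a copy of) the bundle functor `T^μ`: the manifolds `T(π)` are identified, by maps `ι`,
with the submanifolds `∏_μ G_α(π) ⊆ ∏_α G_α(M_α)` (that is, `ι` is an injective immersion and a
topological embedding with this image) so that `T(f)` is the restriction of `∏_α G_α(f_α)` and the
bundle projection is the restriction of the projection `∏_α G_α(M_α) → ∏_α M_α`. -/
structure IsT {Λ : Type u} [PartialOrder Λ] (μ : InductiveSystem Λ) (T : PPBundleFunctorFM Λ)
    (ι : ∀ (π : MultifiberedMfd Λ) (α : Λ), T.total.obj π ⟶ (μ.obj α).total.obj (π.stage α)) :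
    Prop where
  isEmbedding : ∀ π, Topology.IsEmbedding fun t α => (ι π α).toFun t
  immersion : ∀ π t (v : TangentSpace 𝓘(ℝ, (T.total.obj π).model) t),
    (∀ α, mfderiv 𝓘(ℝ, (T.total.obj π).model) 𝓘(ℝ, ((μ.obj α).total.obj (π.stage α)).model)
      (ι π α).toFun t v = 0) → v = 0
  range_eq : ∀ π, Set.range (fun t α => (ι π α).toFun t) = prodSet μ π
  map_eq : ∀ {π π' : MultifiberedMfd Λ} (f : π ⟶ π') (α : Λ),
    T.total.map f ≫ ι π' α = ι π α ≫ (μ.obj α).total.map (f.app α)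
  proj_eq : ∀ (π : MultifiberedMfd Λ) (α : Λ),
    T.proj.app π ≫ π.proj α = ι π α ≫ (μ.obj α).proj.app (π.stage α)

end

/-! Both kinds of data are determined by what they do on coordinate projections, and there they
agree.

The functor i_α is right adjoint to π ↦ M_α. Applying F to the units π → i_α(M_α) gives maps F(π) →
G^F_α(M_α), and the naturality of the units makes these a compatible family (`compat_emb`). The
standard system of projections ℝ^n → ℝ^{H_α} is the product of the i_{p(i)}(ℝ) (`stdIsLimit`), so F
sends it to ∏_i G_{p(i)}(ℝ). On the other side, G_α(ℝ^{H_α}) is a product of copies of G_α(ℝ), and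
compatibility forces the i-th coordinate of x_α to be the image under μ^{p(i)}_α of the i-th
coordinate of x_{p(i)} (`eq_stdParam`). Hence the compatible families over a standard system also
form ∏_i G_{p(i)}(ℝ). Every π is locally standard, so locality of F and of the G_α extends the
comparison to all π: F is a copy of T^μ for μ = μ^F (`isT_emb`). Since copies of T^μ depend
functorially on μ (`mapIso`), F ↦ μ^F is injective on classes.

Conversely, a compatible family over i_α(X) is determined by its component at α, which is an
arbitrary element of G_α(X). So the system of T^μ is μ again (`systemIso`), which gives surjectivity
and the inverse once T^μ exists. To construct T^μ(π), the set of compatible families is covered by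
parametrizations with domain ∏_i G_{p(i)}(ℝ) (`exists_prodMfd`). Products are preserved because they
are formed stagewise and the G_α preserve them.

The analytic tool is `JointEmb`: a family of maps out of N that is jointly an immersion and a
topological embedding. By the inverse function theorem it detects smoothness of maps into N
(`JointEmb.smoothAt`). Thus maps into T^μ(π) are the same as compatible families of maps, and
identities are checked in components. -/

open CategoryTheory CategoryTheory.Limits
open scoped Manifold ContDiff

noncomputable section

/-! ### Smooth maps and their derivatives -/

namespace Mfd

/-- Smoothness of a map of manifolds at a point. -/
abbrev SmoothAt {M N : Mfd} (f : M → N) (x : M) : Prop :=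
  ContMDiffAt 𝓘(ℝ, M.model) 𝓘(ℝ, N.model) ∞ f x

theorem smoothAt (M N : Mfd) (f : M ⟶ N) (x : M) : SmoothAt f.toFun x := f.contMDiff x

theorem continuous {M N : Mfd} (f : M ⟶ N) : Continuous f.toFun := f.contMDiff.continuous

/-- The derivative of a smooth map at a point, as a map of the model spaces. -/
def deriv {M N : Mfd} (f : M ⟶ N) (x : M) : M.model →L[ℝ] N.model :=
  mfderiv 𝓘(ℝ, M.model) 𝓘(ℝ, N.model) f.toFun x

theorem mdifferentiableAt {M N : Mfd} (f : M ⟶ N) (x : M) :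
    MDifferentiableAt 𝓘(ℝ, M.model) 𝓘(ℝ, N.model) f.toFun x :=
  (f.contMDiff x).mdifferentiableAt (by simp)

theorem hasMFDerivAt {M N : Mfd} (f : M ⟶ N) (x : M) :
    HasMFDerivAt 𝓘(ℝ, M.model) 𝓘(ℝ, N.model) f.toFun x (deriv f x) :=
  (mdifferentiableAt f x).hasMFDerivAt

theorem deriv_comp {M N P : Mfd} (f : M ⟶ N) (g : N ⟶ P) (x : M) :
    deriv (f ≫ g) x = (deriv g (f.toFun x)).comp (deriv f x) :=
  mfderiv_comp x (mdifferentiableAt g _) (mdifferentiableAt f x)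

theorem deriv_comp_apply {M N P : Mfd} (f : M ⟶ N) (g : N ⟶ P) (x : M) (v : M.model) :
    deriv (f ≫ g) x v = deriv g (f.toFun x) (deriv f x v) := by
  rw [deriv_comp]; rfl

theorem isSurjSubmersion_iff {M N : Mfd} (f : M ⟶ N) : IsSurjSubmersion f ↔
    Function.Surjective f.toFun ∧ ∀ x, Function.Surjective (deriv f x) := Iff.rfl

theorem congr_toFun {M N : Mfd} {f g : M ⟶ N} (h : f = g) (x : M) : f.toFun x = g.toFun x := by
  rw [h]

/-- A constant map. -/
def const (M : Mfd) {N : Mfd} (y : N) : M ⟶ N := ⟨fun _ => y, contMDiff_const⟩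

theorem hom_inv_toFun {M N : Mfd} (e : M ≅ N) (x : M) : e.inv.toFun (e.hom.toFun x) = x :=
  congr_toFun e.hom_inv_id x

theorem inv_hom_toFun {M N : Mfd} (e : M ≅ N) (x : N) : e.hom.toFun (e.inv.toFun x) = x :=
  congr_toFun e.inv_hom_id x

/-! ### Open embeddings -/

/-- The left inverse may be arbitrary off the image, so inverses obtained by choice are allowed; a
single partial diffeomorphism with source all of M serves every point. -/
theorem isOpenEmb_of_leftInverse {M N : Mfd} (f : M ⟶ N) (g : N → M)
    (hr : IsOpen (Set.range f.toFun)) (hg : ∀ x, g (f.toFun x) = x)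
    (hs : ∀ x, SmoothAt g (f.toFun x)) : IsOpenEmb f := by
  refine ⟨Function.LeftInverse.injective hg, fun x => ?_⟩
  exact PartialDiffeomorph.isLocalDiffeomorphAt 𝓘(ℝ, M.model) 𝓘(ℝ, N.model) ∞
    { toFun := f.toFun
      invFun := g
      source := Set.univ
      target := Set.range f.toFun
      map_source' := fun x _ => ⟨x, rfl⟩
      map_target' := fun _ _ => Set.mem_univ _
      left_inv' := fun x _ => hg x
      right_inv' := by
        rintro _ ⟨x, rfl⟩
        rw [hg]
      open_source := isOpen_univ
      open_target := hr
      contMDiffOn_toFun := f.contMDiff.contMDiffOn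
      contMDiffOn_invFun := by
        rintro _ ⟨x, rfl⟩
        exact (hs x).contMDiffWithinAt } (Set.mem_univ x)

theorem IsOpenEmb.isOpen_range {M N : Mfd} {f : M ⟶ N} (h : IsOpenEmb f) :
    IsOpen (Set.range f.toFun) := h.2.isOpen_range

theorem IsOpenEmb.isOpenEmbedding {M N : Mfd} {f : M ⟶ N} (h : IsOpenEmb f) :
    Topology.IsOpenEmbedding f.toFun :=
  .of_continuous_injective_isOpenMap (continuous f) h.1 h.2.isOpenMap

/-- The inverse of an open embedding. -/
def IsOpenEmb.inv {M N : Mfd} {f : M ⟶ N} (_ : IsOpenEmb f) : N → M := Function.invFun f.toFun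

theorem IsOpenEmb.inv_apply {M N : Mfd} {f : M ⟶ N} (h : IsOpenEmb f) (x : M) :
    h.inv (f.toFun x) = x := Function.leftInverse_invFun h.1 x

/-- By injectivity the chosen global inverse agrees, near the image point, with the inverse of a
local diffeomorphism. -/
theorem IsOpenEmb.smoothAt_inv {M N : Mfd} {f : M ⟶ N} (h : IsOpenEmb f) (x : M) :
    SmoothAt h.inv (f.toFun x) := by
  obtain ⟨Φ, hx, hΦ⟩ := h.2 x
  have hy : f.toFun x ∈ Φ.target := by
    rw [hΦ hx]
    exact Φ.map_source hx
  have h1 : SmoothAt Φ.symm (f.toFun x) :=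
    Φ.contMDiffOn_invFun.contMDiffAt (Φ.open_target.mem_nhds hy)
  refine h1.congr_of_eventuallyEq ?_
  filter_upwards [Φ.open_target.mem_nhds hy] with y hy
  have h2 : f.toFun (Φ.invFun y) = y := (hΦ (Φ.map_target hy)).trans (Φ.right_inv hy)
  have := h.inv_apply (Φ.invFun y)
  rw [h2] at this
  exact this

theorem IsOpenEmb.deriv_bijective {M N : Mfd} {f : M ⟶ N} (h : IsOpenEmb f) (x : M) :
    Function.Bijective (deriv f x) := by
  have := ((h.2 x).mfderivToContinuousLinearEquiv (by simp)).bijective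
  rwa [← ContinuousLinearEquiv.coe_coe, IsLocalDiffeomorphAt.mfderivToContinuousLinearEquiv_coe]
    at this

theorem isOpenEmb_of_isIso {M N : Mfd} (e : M ≅ N) : IsOpenEmb e.hom := by
  refine isOpenEmb_of_leftInverse _ e.inv.toFun ?_ (hom_inv_toFun e) fun x => smoothAt _ _ _ _
  rw [Function.Surjective.range_eq fun y => ⟨_, inv_hom_toFun e y⟩]
  exact isOpen_univ

/-! ### Vector spaces -/

/-- A finite-dimensional vector space as a manifold. -/
abbrev vec (V : Type) [NormedAddCommGroup V] [NormedSpace ℝ V] [FiniteDimensional ℝ V] : Mfd where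
  carrier := V
  model := V
  secondCountable := by
    have := FiniteDimensional.proper ℝ V
    infer_instance

/-- A linear map as a smooth map. -/
def linear {V W : Type} [NormedAddCommGroup V] [NormedSpace ℝ V] [FiniteDimensional ℝ V]
    [NormedAddCommGroup W] [NormedSpace ℝ W] [FiniteDimensional ℝ W] (f : V →L[ℝ] W) :
    vec V ⟶ vec W := ⟨f, f.contMDiff⟩

theorem deriv_linear {V W : Type} [NormedAddCommGroup V] [NormedSpace ℝ V] [FiniteDimensional ℝ V]
    [NormedAddCommGroup W] [NormedSpace ℝ W] [FiniteDimensional ℝ W] (f : V →L[ℝ] W) (x : V) :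
    deriv (linear f) x = f :=
  f.hasMFDerivAt.mfderiv

/-! ### Finite products -/

section pi

variable {K : Type} [Fintype K]

/-- The product of a finite family of manifolds. -/
def pi (N : K → Mfd) : Mfd where
  carrier := ∀ k, N k
  model := ∀ k, (N k).model
  charted := piChartedSpace (fun k => (N k).model) (fun k => (N k).carrier)
  smooth := by
    let _ : ChartedSpace (∀ k, (N k).model) (∀ k, N k) :=
      piChartedSpace (fun k => (N k).model) (fun k => (N k).carrier)
    refine isManifold_of_contDiffOn _ _ _ ?_
    rintro _ _ ⟨e, he, rfl⟩ ⟨e', he', rfl⟩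
    refine contDiffOn_pi.2 fun k => ?_
    have h1 : ContDiffOn ℝ ∞ ((e k).symm.trans (e' k)) ((e k).symm.trans (e' k)).source := by
      have := HasGroupoid.compatible (G := contDiffGroupoid ∞ 𝓘(ℝ, (N k).model))
        (he k trivial) (he' k trivial)
      rw [contDiffGroupoid, mem_groupoid_of_pregroupoid] at this
      simpa [contDiffPregroupoid] using this.1
    refine h1.comp (t := ((e k).symm.trans (e' k)).source) (s := _)
      (f := fun v : ∀ k, (N k).model => v k)
      (ContinuousLinearMap.proj (R := ℝ) (φ := fun k => (N k).model) k).contDiff.contDiffOn ?_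
    rintro v ⟨⟨hv, hv'⟩, -⟩
    exact ⟨hv k trivial, hv' k trivial⟩

variable {N : K → Mfd}

theorem smoothAt_pi_iff {Z : Mfd} {f : Z → pi N} {z : Z} :
    SmoothAt f z ↔ ∀ k, SmoothAt (fun z => f z k) z := by
  have hc : ContinuousAt f z ↔ ∀ k, ContinuousAt (fun z => f z k) z := continuousAt_pi
  rw [SmoothAt, contMDiffAt_iff_target, hc]
  simp only [SmoothAt, contMDiffAt_iff_target (f := fun z => f z _), forall_and]
  exact and_congr Iff.rfl contMDiffAt_pi_space

/-- The projections of a product. -/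
def piProj (N : K → Mfd) (k : K) : pi N ⟶ N k :=
  ⟨fun x => x k, fun _ => smoothAt_pi_iff.1 contMDiffAt_id k⟩

/-- The map to a product with given components. -/
def piLift {Z : Mfd} (f : ∀ k, Z ⟶ N k) : Z ⟶ pi N :=
  ⟨fun z k => (f k).toFun z, fun z => smoothAt_pi_iff.2 fun k => (f k).contMDiff z⟩

@[simp]
theorem piLift_proj {Z : Mfd} (f : ∀ k, Z ⟶ N k) (k : K) : piLift f ≫ piProj N k = f k := rfl

theorem pi_hom_ext {Z : Mfd} {f g : Z ⟶ pi N} (h : ∀ k, f ≫ piProj N k = g ≫ piProj N k) :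
    f = g := by
  ext x
  funext k
  exact congr_toFun (h k) x

/-- The product is a categorical product. -/
def piIsLimit (N : K → Mfd) : IsLimit (Fan.mk (pi N) (piProj N)) :=
  Fan.IsLimit.mk _ (fun s => piLift fun k => s.proj k) (fun _ _ => rfl) fun _ _ hm => pi_hom_ext hm

instance : HasFiniteProducts Mfd :=
  ⟨fun n => ⟨fun F => by
    have : HasLimit (Discrete.functor (F.obj ∘ Discrete.mk)) := ⟨⟨_, piIsLimit fun k => F.obj ⟨k⟩⟩⟩
    exact hasLimit_of_iso (Discrete.natIsoFunctor (F := F)).symm⟩⟩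

/-- Charts of the product are products of charts, so in the preferred charts the projection is the
linear projection on the whole chart target. -/
theorem deriv_piProj (N : K → Mfd) (k : K) (x : pi N) :
    deriv (piProj N k) x = ContinuousLinearMap.proj (φ := fun k => (N k).model) k := by
  refine HasMFDerivAt.mfderiv ⟨(continuous (piProj N k)).continuousAt, ?_⟩
  refine (ContinuousLinearMap.hasFDerivWithinAt
    (ContinuousLinearMap.proj (R := ℝ) (φ := fun k => (N k).model) k)).congr_of_eventuallyEq ?_ ?_
  · refine Filter.eventually_of_mem (U := (extChartAt 𝓘(ℝ, (pi N).model) x).target) ?_ ?_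
    · exact mem_nhdsWithin_of_mem_nhds (extChartAt_target_mem_nhds (I := 𝓘(ℝ, (pi N).model)) x)
    · intro v hv
      have hv' : v ∈ (chartAt (pi N).model x).target := by
        rw [extChartAt_target] at hv
        exact hv.1
      exact (chartAt (N k).model (x k)).right_inv (hv' k trivial)
  · exact (chartAt (N k).model (x k)).right_inv
      ((chartAt (N k).model (x k)).map_source (mem_chart_source _ _))

theorem deriv_piLift {Z : Mfd} (f : ∀ k, Z ⟶ N k) (z : Z) (v : Z.model) (k : K) :
    deriv (piLift f) z v k = deriv (f k) z v := by
  have := deriv_comp_apply (piLift f) (piProj N k) z v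
  rw [piLift_proj, deriv_piProj] at this
  exact this.symm

/-- The product of smooth maps. -/
def piMap {N' : K → Mfd} (f : ∀ k, N k ⟶ N' k) : pi N ⟶ pi N' :=
  piLift fun k => piProj N k ≫ f k

theorem isSurjSubmersion_piMap {N' : K → Mfd} {f : ∀ k, N k ⟶ N' k}
    (hf : ∀ k, IsSurjSubmersion (f k)) : IsSurjSubmersion (piMap f) := by
  refine ⟨fun y => ?_, fun x w => ?_⟩
  · choose x hx using fun k => (hf k).1 (y k)
    exact ⟨x, funext hx⟩
  · choose v hv using fun k => (hf k).2 (x k) (w k)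
    refine ⟨v, funext fun k => ?_⟩
    refine (deriv_piLift _ x v k).trans ((deriv_comp_apply (piProj N k) (f k) x v).trans ?_)
    rw [deriv_piProj]
    exact hv k

end pi

end Mfd

/-! ### Jointly embedding families of smooth maps -/

namespace Mfd

/-- A family of smooth maps which is jointly an immersion and a topological embedding. -/
structure JointEmb {A : Type*} {N : Mfd} {D : A → Mfd} (ι : ∀ a, N ⟶ D a) : Prop where
  isEmbedding : Topology.IsEmbedding fun t a => (ι a).toFun t
  immersion : ∀ t (v : N.model), (∀ a, deriv (ι a) t v = 0) → v = 0

namespace JointEmb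

variable {A : Type*} {N : Mfd} {D : A → Mfd} {ι : ∀ a, N ⟶ D a}

theorem point_ext (h : JointEmb ι) {x y : N} (hxy : ∀ a, (ι a).toFun x = (ι a).toFun y) : x = y :=
  h.isEmbedding.injective (funext hxy)

theorem hom_ext (h : JointEmb ι) {Z : Mfd} {f g : Z ⟶ N} (hfg : ∀ a, f ≫ ι a = g ≫ ι a) :
    f = g := by
  ext z
  exact h.point_ext fun a => congr_toFun (hfg a) z

/-- Near each point, the manifold is a smooth retract of the target of a jointly embedding family. -/
theorem exists_local_retraction [Fintype A] (h : JointEmb ι) (t : N) :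
    ∃ g : (∀ a, (D a).model) → N.model,
      ContDiffAt ℝ ∞ g (fun a => extChartAt 𝓘(ℝ, (D a).model) ((ι a).toFun t) ((ι a).toFun t)) ∧
      ∀ᶠ s in nhds t, g (fun a => extChartAt 𝓘(ℝ, (D a).model) ((ι a).toFun t) ((ι a).toFun s)) =
        extChartAt 𝓘(ℝ, N.model) t s := by
  let φ := extChartAt 𝓘(ℝ, N.model) t
  let F : N.model → ∀ a, (D a).model := fun e a =>
    writtenInExtChartAt 𝓘(ℝ, N.model) 𝓘(ℝ, (D a).model) t (ι a).toFun e
  have hFt : F (φ t) =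
      fun a => extChartAt 𝓘(ℝ, (D a).model) ((ι a).toFun t) ((ι a).toFun t) := by
    funext a
    simp [F, φ, writtenInExtChartAt]
  have hF : ContDiffAt ℝ ∞ F (φ t) := contDiffAt_pi.2 fun a => by
    have := (contMDiffAt_iff.1 (smoothAt _ _ (ι a) t)).2
    rw [ModelWithCorners.range_eq_univ, contDiffWithinAt_univ] at this
    exact this
  let F' : N.model →L[ℝ] ∀ a, (D a).model := ContinuousLinearMap.pi fun a => deriv (ι a) t
  have hF' : HasFDerivAt F F' (φ t) := hasFDerivAt_pi.2 fun a => by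
    have : HasFDerivWithinAt (fun x => F x a) (deriv (ι a) t) (Set.range 𝓘(ℝ, N.model)) (φ t) :=
      (hasMFDerivAt (ι a) t).2
    rw [ModelWithCorners.range_eq_univ, hasFDerivWithinAt_univ] at this
    exact this
  have hinj : LinearMap.ker (F' : N.model →ₗ[ℝ] ∀ a, (D a).model) = ⊥ := by
    refine LinearMap.ker_eq_bot'.2 fun v hv => h.immersion t v fun a => ?_
    exact congrFun hv a
  -- The joint derivative is injective. After composing with a linear left inverse, the coordinate
  -- expression `F` has derivative the identity, so the inverse function theorem applies; the
  -- retraction is `L'` followed by the local inverse.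
  obtain ⟨L, hL⟩ := LinearMap.exists_leftInverse_of_injective _ hinj
  let L' := LinearMap.toContinuousLinearMap L
  have hG : ContDiffAt ℝ ∞ (L' ∘ F) (φ t) := L'.contDiff.contDiffAt.comp _ hF
  have hG' : HasFDerivAt (L' ∘ F) (ContinuousLinearEquiv.refl ℝ N.model : N.model →L[ℝ] N.model)
      (φ t) := by
    refine (L'.hasFDerivAt.comp _ hF').congr_fderiv ?_
    ext v
    exact LinearMap.congr_fun hL v
  have hn : (∞ : WithTop ℕ∞) ≠ 0 := by simp
  refine ⟨hG.localInverse hG' hn ∘ L', ?_, ?_⟩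
  · refine ContDiffAt.comp _ ?_ L'.contDiff.contDiffAt
    rw [← hFt]
    exact hG.to_localInverse hG' hn
  · have h1 := (hG.hasStrictFDerivAt' hG' hn).eventually_left_inverse
    have h2 : Filter.Tendsto φ (nhds t) (nhds (φ t)) := continuousAt_extChartAt t
    filter_upwards [h2.eventually h1, extChartAt_source_mem_nhds (I := 𝓘(ℝ, N.model)) t]
      with s hs hs'
    refine Eq.trans ?_ hs
    change (hG.hasStrictFDerivAt' hG' hn).localInverse _ _ _ _ = _
    congr 2
    funext a
    change _ = extChartAt 𝓘(ℝ, (D a).model) ((ι a).toFun t) ((ι a).toFun (φ.symm (φ s)))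
    rw [φ.left_inv hs']

/-- Smoothness of a map into a manifold is detected by a jointly embedding family. -/
theorem smoothAt [Finite A] (h : JointEmb ι) {Z : Mfd} {f : Z → N} {z : Z}
    (hf : ∀ a, SmoothAt (fun z => (ι a).toFun (f z)) z) : SmoothAt f z := by
  have := Fintype.ofFinite A
  have hc : ContinuousAt f z := by
    rw [h.isEmbedding.isInducing.continuousAt_iff]
    exact continuousAt_pi.2 fun a => (hf a).continuousAt
  refine contMDiffAt_iff_target.2 ⟨hc, ?_⟩
  -- The retraction recovers f from its components, but only near f z. This is why continuity, which
  -- comes from the topological embedding, had to be settled first.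
  obtain ⟨g, hg, hg'⟩ := h.exists_local_retraction (f z)
  have h1 : ContMDiffAt 𝓘(ℝ, Z.model) 𝓘(ℝ, ∀ a, (D a).model) ∞ (fun z' a =>
      extChartAt 𝓘(ℝ, (D a).model) ((ι a).toFun (f z)) ((ι a).toFun (f z'))) z :=
    contMDiffAt_pi_space.2 fun a => (contMDiffAt_iff_target.1 (hf a)).2
  refine (hg.contMDiffAt.comp z h1).congr_of_eventuallyEq ?_
  filter_upwards [hc.eventually hg'] with z' hz'
  exact hz'.symm

/-- The lift of a family of smooth maps with values in the image of a jointly embedding family. -/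
theorem exists_lift [Finite A] (h : JointEmb ι) {Z : Mfd} (f : ∀ a, Z ⟶ D a)
    (hf : ∀ z, (fun a => (f a).toFun z) ∈ Set.range fun t a => (ι a).toFun t) :
    ∃ g : Z ⟶ N, ∀ a, g ≫ ι a = f a := by
  choose g hg using hf
  have hg' : ∀ z a, (ι a).toFun (g z) = (f a).toFun z := fun z a => congrFun (hg z) a
  refine ⟨⟨g, fun z => h.smoothAt fun a => ?_⟩, fun a => ?_⟩
  · simp only [hg']
    exact Mfd.smoothAt _ _ (f a) z
  · ext z
    exact hg' z a

/-- Whatever separates points, topology and tangent vectors after further maps already does so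
before. The reindexing `a` allows the test to use only selected components, below the coordinate i
of the stage p(i). -/
theorem of_comp {B : Type*} {E : B → Mfd} (a : B → A) (r : ∀ b, D (a b) ⟶ E b)
    (h : JointEmb fun b => ι (a b) ≫ r b) : JointEmb ι where
  isEmbedding := by
    refine Topology.IsEmbedding.of_comp (f := fun t a => (ι a).toFun t)
      (g := fun (d : ∀ a, D a) b => (r b).toFun (d (a b))) ?_ ?_ h.isEmbedding
    · exact continuous_pi fun a => continuous (ι a)
    · exact continuous_pi fun b => (continuous (r b)).comp (continuous_apply _)
  immersion t v hv := h.immersion t v fun b => by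
    rw [deriv_comp_apply, hv, map_zero]

theorem comp_openEmb [Finite A] {D' : A → Mfd} (h : JointEmb ι) {g : ∀ a, D a ⟶ D' a}
    (hg : ∀ a, IsOpenEmb (g a)) : JointEmb fun a => ι a ≫ g a where
  isEmbedding :=
    (Topology.IsEmbedding.piMap fun a => (hg a).isOpenEmbedding.isEmbedding).comp h.isEmbedding
  immersion t v hv := h.immersion t v fun a => by
    have h1 := hv a
    rw [deriv_comp_apply] at h1
    exact ((hg a).deriv_bijective _).1 (h1.trans (map_zero _).symm)

theorem iso_comp {N' : Mfd} (e : N' ≅ N) (h : JointEmb ι) : JointEmb fun a => e.hom ≫ ι a where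
  isEmbedding := h.isEmbedding.comp (isOpenEmb_of_isIso e).isOpenEmbedding.isEmbedding
  immersion t v hv := by
    have : deriv e.hom t v = 0 := h.immersion _ _ fun a => by rw [← deriv_comp_apply, hv]
    exact ((isOpenEmb_of_isIso e).deriv_bijective t).1 (this.trans (map_zero _).symm)

theorem piProj {K : Type} [Fintype K] (N : K → Mfd) : JointEmb (piProj N) where
  isEmbedding := .id
  immersion t v hv := funext fun k => by
    have := hv k
    rwa [deriv_piProj] at this

/-- Product preservation yields products only up to isomorphism; the concrete product, whose joint
projection is the identity, settles the matter. -/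
theorem of_isLimit {K : Type} [Finite K] {N : K → Mfd} {c : Fan N} (hc : IsLimit c) :
    JointEmb fun k => c.proj k := by
  have := Fintype.ofFinite K
  have := (JointEmb.piProj N).iso_comp (hc.conePointUniqueUpToIso (piIsLimit N))
  convert this using 2 with k
  exact (hc.conePointUniqueUpToIso_hom_comp (piIsLimit N) ⟨k⟩).symm

/-- A map between manifolds is an open embedding if it is the restriction of open embeddings
along jointly embedding families and its image is cut out by their images. -/
theorem isOpenEmb [Finite A] {N' : Mfd} {D' : A → Mfd} {ι' : ∀ a, N' ⟶ D' a} (h : JointEmb ι)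
    {f : N ⟶ N'} {g : ∀ a, D a ⟶ D' a} (hg : ∀ a, IsOpenEmb (g a))
    (hfg : ∀ a, f ≫ ι' a = ι a ≫ g a)
    (hr : ∀ y, (∀ a, (ι' a).toFun y ∈ Set.range (g a).toFun) → y ∈ Set.range f.toFun) :
    IsOpenEmb f := by
  have hfg' : ∀ x a, (ι' a).toFun (f.toFun x) = (g a).toFun ((ι a).toFun x) :=
    fun x a => congr_toFun (hfg a) x
  have hinj : Function.Injective f.toFun := fun x y hxy => h.point_ext fun a =>
    (hg a).1 (by rw [← hfg', ← hfg', hxy])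
  have hrange : Set.range f.toFun = ⋂ a, (ι' a).toFun ⁻¹' Set.range (g a).toFun := by
    refine Set.Subset.antisymm ?_ fun y hy => hr y fun a => Set.mem_iInter.1 hy a
    rintro _ ⟨x, rfl⟩
    exact Set.mem_iInter.2 fun a => ⟨_, (hfg' x a).symm⟩
  have hopen : IsOpen (Set.range f.toFun) := by
    rw [hrange]
    exact isOpen_iInter_of_finite fun a => (hg a).isOpen_range.preimage (continuous _)
  refine isOpenEmb_of_leftInverse f (Function.invFun f.toFun) hopen
    (Function.leftInverse_invFun hinj) fun x => h.smoothAt fun a => ?_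
  -- On the open image of f, the a-th component of the inverse of f is the inverse of g_a applied to
  -- the a-th component.
  have h1 : SmoothAt (fun y => (hg a).inv ((ι' a).toFun y)) (f.toFun x) := by
    refine ContMDiffAt.comp _ ?_ (Mfd.smoothAt _ _ (ι' a) _)
    rw [hfg']
    exact (hg a).smoothAt_inv _
  refine h1.congr_of_eventuallyEq ?_
  filter_upwards [hopen.mem_nhds ⟨x, rfl⟩]
  rintro _ ⟨z, rfl⟩
  rw [Function.leftInverse_invFun hinj, hfg', IsOpenEmb.inv_apply]

/-- Being jointly embedding can be checked locally on the targets. -/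
theorem of_local [Finite A]
    (H : ∀ t : N, ∃ (Q : Mfd) (c : Q ⟶ N) (E : A → Mfd) (κ : ∀ a, Q ⟶ E a) (g : ∀ a, E a ⟶ D a),
      t ∈ Set.range c.toFun ∧ IsOpenEmb c ∧ JointEmb κ ∧ (∀ a, IsOpenEmb (g a)) ∧
      (∀ a, c ≫ ι a = κ a ≫ g a) ∧
      ∀ s, (∀ a, (ι a).toFun s ∈ Set.range (g a).toFun) → s ∈ Set.range c.toFun) :
    JointEmb ι where
  isEmbedding := by
    refine ⟨⟨?_⟩, ?_⟩
    · refine le_antisymm ?_ ?_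
      · exact (continuous_pi fun a => continuous (ι a)).le_induced
      · refine le_of_nhds_le_nhds fun t => ?_
        rw [nhds_induced]
        obtain ⟨Q, c, E, κ, g, ⟨q, rfl⟩, hc, hκ, hg, hcomp, hr⟩ := H t
        have hcomp' : ∀ q a, (ι a).toFun (c.toFun q) = (g a).toFun ((κ a).toFun q) :=
          fun q a => congr_toFun (hcomp a) q
        intro U hU
        have hU' : c.toFun ⁻¹' U ∈ nhds q := (continuous c).continuousAt hU
        rw [hκ.isEmbedding.isInducing.nhds_eq_comap] at hU'
        obtain ⟨V, hV, hVU⟩ := hU'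
        have hG : Topology.IsOpenEmbedding (Pi.map fun a => (g a).toFun) :=
          .piMap fun a => (hg a).isOpenEmbedding
        -- This set is a neighbourhood because the product of the g_a is an open map. Its preimage
        -- meets only the range of c, by `hr`: no point of N outside the local piece can have its
        -- image close to that of the given one. The same condition gives injectivity below.
        refine ⟨Pi.map (fun a => (g a).toFun) '' V, ?_, ?_⟩
        · have := hG.isOpenMap.image_mem_nhds hV
          convert this using 2
          funext a
          exact hcomp' q a
        · rintro s ⟨v, hv, hvs⟩
          obtain ⟨q', rfl⟩ := hr s fun a => ⟨v a, congrFun hvs a⟩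
          have : v = fun a => (κ a).toFun q' := hG.injective (hvs.trans (funext fun a => hcomp' q' a))
          subst this
          exact hVU hv
    · intro t s hts
      obtain ⟨Q, c, E, κ, g, ⟨q, rfl⟩, hc, hκ, hg, hcomp, hr⟩ := H t
      have hcomp' : ∀ q a, (ι a).toFun (c.toFun q) = (g a).toFun ((κ a).toFun q) :=
        fun q a => congr_toFun (hcomp a) q
      obtain ⟨q', rfl⟩ := hr s fun a => ⟨(κ a).toFun q, by
        rw [← hcomp']
        exact congrFun hts a⟩
      congr 1
      refine hκ.point_ext fun a => (hg a).1 ?_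
      rw [← hcomp', ← hcomp']
      exact congrFun hts a
  immersion t v hv := by
    obtain ⟨Q, c, E, κ, g, ⟨q, rfl⟩, hc, hκ, hg, hcomp, hr⟩ := H t
    obtain ⟨w, rfl⟩ := (hc.deriv_bijective q).2 v
    have : w = 0 := hκ.immersion q w fun a => by
      have h1 : deriv (g a) ((κ a).toFun q) (deriv (κ a) q w) = 0 := by
        rw [← deriv_comp_apply, ← hcomp a, deriv_comp_apply]
        exact hv a
      exact ((hg a).deriv_bijective _).1 (h1.trans (map_zero _).symm)
    rw [this, map_zero]

end JointEmb

end Mfd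

namespace Mfd

/-! ### Submanifolds -/

/-- A topological space `S` embedded in a product of manifolds and covered by open subsets which
are parametrized by jointly embedding families of smooth maps defined on a manifold `Q`. -/
structure ParamSpace {A : Type*} (D : A → Mfd) where
  S : Type
  [top : TopologicalSpace S]
  ι : S → ∀ a, D a
  isEmbedding : Topology.IsEmbedding ι
  Q : Mfd
  c : S → Q → S
  c_open : ∀ s, Topology.IsOpenEmbedding (c s)
  mem_range : ∀ s, s ∈ Set.range (c s)
  κ : S → ∀ a, Q ⟶ D a
  κ_emb : ∀ s, JointEmb (κ s)
  ι_c : ∀ s q a, ι (c s q) a = (κ s a).toFun q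

namespace ParamSpace

attribute [instance] ParamSpace.top

variable {A : Type*} {D : A → Mfd} (P : ParamSpace D)

/-- The parametrization at a point as a partial homeomorphism. -/
def homeo (s : P.S) : OpenPartialHomeomorph P.Q P.S :=
  (P.c_open s).toOpenPartialHomeomorph (P.c s)

theorem homeo_target (s : P.S) : (P.homeo s).target = Set.range (P.c s) := by
  simp [homeo]

theorem homeo_symm_c (s : P.S) (q : P.Q) : (P.homeo s).symm (P.c s q) = q :=
  (P.homeo s).left_inv (Set.mem_univ q)

theorem c_homeo_symm (s : P.S) {t : P.S} (ht : t ∈ Set.range (P.c s)) :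
    P.c s ((P.homeo s).symm t) = t := by
  obtain ⟨q, rfl⟩ := ht
  rw [homeo_symm_c]

variable [Finite A]

/-- Composed with the jointly embedding family `P.κ s'`, the change of parameters becomes `P.κ s`,
which is smooth. -/
theorem smoothAt_transition (s s' : P.S) (q : P.Q) (hq : P.c s q ∈ Set.range (P.c s')) :
    SmoothAt (M := P.Q) (N := P.Q) (fun q' => (P.homeo s').symm (P.c s q')) q := by
  refine (P.κ_emb s').smoothAt fun a => ?_
  refine (Mfd.smoothAt _ _ (P.κ s a) q).congr_of_eventuallyEq ?_
  filter_upwards [((P.c_open s').isOpen_range.preimage (P.c_open s).continuous).mem_nhds hq]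
    with q' hq'
  rw [← ι_c, c_homeo_symm _ _ hq', ι_c]

/-- The chart at a point. -/
def chart (s : P.S) : OpenPartialHomeomorph P.S P.Q.model :=
  (P.homeo s).symm.trans (chartAt P.Q.model ((P.homeo s).symm s))

instance : ChartedSpace P.Q.model P.S where
  atlas := Set.range P.chart
  chartAt := P.chart
  mem_chart_source s := ⟨(P.homeo_target s).symm ▸ P.mem_range s, mem_chart_source _ _⟩
  chart_mem_atlas s := ⟨s, rfl⟩

instance : IsManifold 𝓘(ℝ, P.Q.model) ∞ P.S := by
  refine isManifold_of_contDiffOn _ _ _ ?_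
  rintro _ _ ⟨s, rfl⟩ ⟨s', rfl⟩ v ⟨⟨hv, hv'⟩, -⟩
  refine ContDiffAt.contDiffWithinAt (contMDiffAt_iff_contDiffAt.1 ?_)
  have h1 : v ∈ (chartAt P.Q.model ((P.homeo s).symm s)).target := hv.1
  have h2 : P.c s ((chartAt P.Q.model ((P.homeo s).symm s)).symm v) ∈ Set.range (P.c s') :=
    P.homeo_target s' ▸ hv'.1
  have h3 := hv'.2
  have e1 : ContMDiffAt 𝓘(ℝ, P.Q.model) 𝓘(ℝ, P.Q.model) ∞
      (chartAt P.Q.model ((P.homeo s).symm s)).symm v :=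
    contMDiffOn_chart_symm.contMDiffAt ((chartAt _ _).open_target.mem_nhds h1)
  have e2 := P.smoothAt_transition s s' _ h2
  have e3 : ContMDiffAt 𝓘(ℝ, P.Q.model) 𝓘(ℝ, P.Q.model) ∞
      (chartAt P.Q.model ((P.homeo s').symm s')) _ :=
    contMDiffOn_chart.contMDiffAt ((chartAt _ _).open_source.mem_nhds h3)
  have e4 := ContMDiffAt.comp v e2 e1
  exact ContMDiffAt.comp (g := chartAt P.Q.model ((P.homeo s').symm s')) v e3 e4

variable [Nonempty P.S]

/-- The manifold defined by a parametrized space. -/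
abbrev mfd : Mfd where
  carrier := P.S
  model := P.Q.model
  t2 := P.isEmbedding.t2Space
  secondCountable := P.isEmbedding.secondCountableTopology

/-- The chart at s is this map followed by a chart of Q, so in that chart it reads as the inverse
chart of Q. -/
theorem smoothAt_homeo_symm (s : P.S) : SmoothAt (M := P.mfd) (N := P.Q) (P.homeo s).symm s := by
  refine contMDiffAt_iff_source.2 (ContMDiffAt.contMDiffWithinAt ?_)
  have hs : ((P.homeo s).symm s) ∈ (chartAt P.Q.model ((P.homeo s).symm s)).source :=
    mem_chart_source _ _
  have e1 : ContMDiffAt 𝓘(ℝ, P.Q.model) 𝓘(ℝ, P.Q.model) ∞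
      (chartAt P.Q.model ((P.homeo s).symm s)).symm (P.chart s s) :=
    contMDiffOn_chart_symm.contMDiffAt ((chartAt _ _).open_target.mem_nhds
      ((chartAt _ _).map_source hs))
  refine e1.congr_of_eventuallyEq (Filter.Eventually.of_forall fun v => ?_)
  exact P.homeo_symm_c s _

/-- The parametrizations are smooth. -/
def param (s : P.S) : P.Q ⟶ P.mfd := ⟨P.c s, fun q => by
  refine contMDiffAt_iff_target.2 ⟨(P.c_open s).continuous.continuousAt, ?_⟩
  have e2 := P.smoothAt_transition s _ q (P.mem_range (P.c s q))
  have e3 : ContMDiffAt 𝓘(ℝ, P.Q.model) 𝓘(ℝ, P.Q.model) ∞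
      (chartAt P.Q.model ((P.homeo (P.c s q)).symm (P.c s q))) _ :=
    contMDiffOn_chart.contMDiffAt ((chartAt _ _).open_source.mem_nhds (mem_chart_source _ _))
  exact ContMDiffAt.comp (g := chartAt P.Q.model ((P.homeo (P.c s q)).symm (P.c s q))) q e3 e2⟩

/-- The components of the embedding are smooth. -/
def incl (a : A) : P.mfd ⟶ D a := ⟨fun s => P.ι s a, fun s => by
  have h1 : ContMDiffAt 𝓘(ℝ, P.mfd.model) 𝓘(ℝ, (D a).model) ∞
      (fun t : P.mfd => (P.κ s a).toFun ((P.homeo s).symm t)) s :=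
    (Mfd.smoothAt _ _ (P.κ s a) _).comp s (P.smoothAt_homeo_symm s)
  refine h1.congr_of_eventuallyEq ?_
  filter_upwards [(P.c_open s).isOpen_range.mem_nhds (P.mem_range s)] with t ht
  rw [← ι_c, c_homeo_symm _ _ ht]⟩

theorem param_incl (s : P.S) (a : A) : P.param s ≫ P.incl a = P.κ s a := by
  ext q
  exact P.ι_c s q a

theorem jointEmb_incl : JointEmb P.incl where
  isEmbedding := P.isEmbedding
  immersion s v hv := by
    have h1 : HasMFDerivAt 𝓘(ℝ, P.mfd.model) 𝓘(ℝ, P.Q.model) (P.homeo s).symm s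
        (mfderiv 𝓘(ℝ, P.mfd.model) 𝓘(ℝ, P.Q.model) (P.homeo s).symm s) :=
      ((P.smoothAt_homeo_symm s).mdifferentiableAt (by simp)).hasMFDerivAt
    have h3 := (hasMFDerivAt (P.param s) ((P.homeo s).symm s)).comp s h1
    have h4 : HasMFDerivAt 𝓘(ℝ, P.mfd.model) 𝓘(ℝ, P.mfd.model) (id : P.mfd → P.mfd) s _ :=
      h3.congr_of_eventuallyEq (by
        filter_upwards [(P.c_open s).isOpen_range.mem_nhds (P.mem_range s)] with t ht
        exact (P.c_homeo_symm s ht).symm)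
    -- Near s the parametrization composed with its inverse is the identity. Hence v is the image of
    -- some w tangent to Q, and the immersivity of `P.κ s` forces w = 0.
    have h5 := hasMFDerivAt_unique h4 (hasMFDerivAt_id s)
    let w : P.Q.model := mfderiv 𝓘(ℝ, P.mfd.model) 𝓘(ℝ, P.Q.model) (P.homeo s).symm s v
    have h6 : deriv (P.param s) ((P.homeo s).symm s) w = v :=
      congrArg (fun L : P.Q.model →L[ℝ] P.Q.model => L v) h5
    have h7 : w = 0 := (P.κ_emb s).immersion ((P.homeo s).symm s) w fun a => by
      rw [← param_incl, deriv_comp_apply, h6]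
      have : (P.param s).toFun ((P.homeo s).symm s) = s := P.c_homeo_symm s (P.mem_range s)
      rw [this]
      exact hv a
    rw [← h6, h7, map_zero]

end ParamSpace

/-- A subset of a finite product of manifolds which is locally parametrized by jointly embedding
families defined on a manifold `Q` is a submanifold. -/
theorem exists_submanifold {A : Type*} [Finite A] {D : A → Mfd} (R : Set (∀ a, D a))
    (hR : R.Nonempty) (Q : Mfd)
    (H : ∀ r ∈ R, ∃ κ : ∀ a, Q ⟶ D a, JointEmb κ ∧ (r ∈ Set.range fun q a => (κ a).toFun q) ∧
      ∃ U, IsOpen U ∧ (Set.range fun q a => (κ a).toFun q) = R ∩ U) :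
    ∃ (N : Mfd) (ι : ∀ a, N ⟶ D a), JointEmb ι ∧ (Set.range fun t a => (ι a).toFun t) = R := by
  -- The index type may lie in any universe, whereas the carrier of a manifold must lie in `Type`;
  -- finiteness of the index type makes the subset small.
  let S : Type := Shrink.{0} R
  let E : R ≃ S := equivShrink.{0} R
  let ι : S → ∀ a, D a := fun s => E.symm s
  let _ : TopologicalSpace S := .induced ι inferInstance
  have hι : Topology.IsEmbedding ι :=
    ⟨⟨rfl⟩, Subtype.val_injective.comp E.symm.injective⟩
  have hιR : Set.range ι = R := by
    change Set.range (Subtype.val ∘ E.symm) = R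
    rw [Set.range_comp, E.symm.surjective.range_eq]
    simp
  have hS : Nonempty S := ⟨E ⟨_, hR.some_mem⟩⟩
  choose κ hκ hmem U hU hrange using fun s : S => H (ι s) (hιR ▸ ⟨s, rfl⟩)
  have hc : ∀ (s : S) q, ∃ t : S, ι t = fun a => (κ s a).toFun q := fun s q => by
    have : (fun a => (κ s a).toFun q) ∈ R := ((hrange s).subset ⟨q, rfl⟩).1
    rwa [← hιR] at this
  choose c hc using hc
  have hιc : ∀ s, ι ∘ c s = fun q a => (κ s a).toFun q := fun s => funext (hc s)
  have hcr : ∀ s, Set.range (c s) = ι ⁻¹' U s := by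
    intro s
    ext t
    constructor
    · rintro ⟨q, rfl⟩
      rw [Set.mem_preimage, hc]
      exact ((hrange s).subset ⟨q, rfl⟩).2
    · intro ht
      obtain ⟨q, hq⟩ := (hrange s).superset ⟨hιR ▸ ⟨t, rfl⟩, ht⟩
      exact ⟨q, hι.injective ((hc s q).trans hq)⟩
  have hcont : ∀ s, Continuous (c s) := fun s => hι.isInducing.continuous_iff.2 (by
    rw [hιc]
    exact (hκ s).isEmbedding.continuous)
  let P : ParamSpace D :=
    { S := S
      ι := ι
      isEmbedding := hι
      Q := Q
      c := c
      c_open := fun s => ⟨.of_comp (hcont s) hι.continuous (by rw [hιc]; exact (hκ s).isEmbedding),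
        by rw [hcr]; exact (hU s).preimage hι.continuous⟩
      mem_range := fun s => by
        obtain ⟨q, hq⟩ := hmem s
        exact ⟨q, hι.injective ((hc s q).trans hq)⟩
      κ := κ
      κ_emb := hκ
      ι_c := fun s q a => congrFun (hc s q) a }
  have : Nonempty P.S := hS
  exact ⟨P.mfd, P.incl, P.jointEmb_incl, hιR⟩

end Mfd

namespace Mfd

theorem isSurjSubmersion_linear {V W : Type} [NormedAddCommGroup V] [NormedSpace ℝ V]
    [FiniteDimensional ℝ V] [NormedAddCommGroup W] [NormedSpace ℝ W] [FiniteDimensional ℝ W]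
    (f : V →L[ℝ] W) (hf : Function.Surjective f) : IsSurjSubmersion (linear f) := by
  refine (isSurjSubmersion_iff _).2 ⟨hf, fun x => ?_⟩
  rw [deriv_linear]
  exact hf

/-! ### Parametrizations by Euclidean spaces -/

section cube

variable {X : Mfd} {I : Type} [Fintype I]
  (k : PartialDiffeomorph 𝓘(ℝ, X.model) 𝓘(ℝ, I → ℝ) X (I → ℝ) ∞) {ε : ℝ} (hε : 0 < ε)
  (hk : ∀ w : I → ℝ, (∀ i, w i ∈ Metric.ball (0 : ℝ) ε) → w ∈ k.target)

theorem univBall_mem (hε : 0 < ε) (t : ℝ) :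
    OpenPartialHomeomorph.univBall (0 : ℝ) ε t ∈ Metric.ball (0 : ℝ) ε := by
  rw [← OpenPartialHomeomorph.univBall_target (0 : ℝ) hε]
  exact OpenPartialHomeomorph.map_source _ (by simp)

/-- The parametrization of a manifold by a Euclidean space obtained by composing a diffeomorphism
of the Euclidean space onto a cube with the inverse of a chart. -/
def cubeParam : vec (I → ℝ) ⟶ X :=
  ⟨fun v => k.symm fun i => OpenPartialHomeomorph.univBall (0 : ℝ) ε (v i), by
    refine k.contMDiffOn_invFun.comp_contMDiff (I := 𝓘(ℝ, I → ℝ))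
      (f := fun v : I → ℝ => fun i => OpenPartialHomeomorph.univBall (0 : ℝ) ε (v i)) ?_ ?_
    · refine ContDiff.contMDiff (contDiff_pi.2 fun i => ?_)
      exact OpenPartialHomeomorph.contDiff_univBall.comp (contDiff_apply ℝ ℝ i)
    · exact fun v => hk _ fun i => univBall_mem hε _⟩

theorem cubeParam_mem_source (v : I → ℝ) : (cubeParam k hε hk).toFun v ∈ k.source :=
  k.map_target (hk _ fun _ => univBall_mem hε _)

theorem chart_cubeParam (v : I → ℝ) : k ((cubeParam k hε hk).toFun v) =
    fun i => OpenPartialHomeomorph.univBall (0 : ℝ) ε (v i) :=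
  k.right_inv (hk _ fun _ => univBall_mem hε _)

theorem isOpenEmb_cubeParam : IsOpenEmb (cubeParam k hε hk) := by
  have hr : Set.range (cubeParam k hε hk).toFun =
      k.source ∩ k ⁻¹' Set.univ.pi fun _ => Metric.ball (0 : ℝ) ε := by
    ext y
    constructor
    · rintro ⟨v, rfl⟩
      refine ⟨cubeParam_mem_source k hε hk v, ?_⟩
      rw [Set.mem_preimage, chart_cubeParam]
      exact fun i _ => univBall_mem hε _
    · rintro ⟨hy, hy'⟩
      refine ⟨fun i => (OpenPartialHomeomorph.univBall (0 : ℝ) ε).symm (k y i), ?_⟩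
      change k.invFun _ = y
      have : (fun i => OpenPartialHomeomorph.univBall (0 : ℝ) ε
          ((OpenPartialHomeomorph.univBall (0 : ℝ) ε).symm (k y i))) = k y := by
        funext i
        refine OpenPartialHomeomorph.right_inv _ ?_
        rw [OpenPartialHomeomorph.univBall_target _ hε]
        exact hy' i trivial
      rw [this]
      exact k.left_inv hy
  refine isOpenEmb_of_leftInverse _
    (fun y i => (OpenPartialHomeomorph.univBall (0 : ℝ) ε).symm (k y i)) ?_ ?_ ?_
  · rw [hr]
    exact k.toOpenPartialHomeomorph.isOpen_inter_preimage
      (isOpen_set_pi Set.finite_univ fun _ _ => Metric.isOpen_ball)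
  · intro v
    rw [chart_cubeParam]
    funext i
    exact OpenPartialHomeomorph.left_inv _ (by simp)
  · intro v
    refine contMDiffAt_pi_space.2 fun i => ?_
    have h1 : ContMDiffAt 𝓘(ℝ, X.model) 𝓘(ℝ, ℝ) ∞ (fun y => k y i)
        ((cubeParam k hε hk).toFun v) :=
      contMDiffAt_pi_space.1 (k.contMDiffOn_toFun.contMDiffAt
        (k.open_source.mem_nhds (cubeParam_mem_source k hε hk v))) i
    have h2 : ContDiffAt ℝ ∞ (OpenPartialHomeomorph.univBall (0 : ℝ) ε).symm
        (k ((cubeParam k hε hk).toFun v) i) := by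
      refine OpenPartialHomeomorph.contDiffOn_univBall_symm.contDiffAt
        (Metric.isOpen_ball.mem_nhds ?_)
      rw [chart_cubeParam]
      exact univBall_mem hε _
    exact ContMDiffAt.comp (f := fun y => k y i)
      (g := (OpenPartialHomeomorph.univBall (0 : ℝ) ε).symm) _ h2.contMDiffAt h1

end cube

end Mfd

namespace MultifiberedMfd

variable {Λ : Type u} [PartialOrder Λ]

open Mfd

/-! ### The standard multifibered manifolds -/

section std

open scoped Classical

variable {n : ℕ} (p : Fin n → Λ)

/-- The manifold `ℝ^{H_α}`. -/
abbrev stdStage (α : Λ) : Mfd := vec ({i // p i ≤ α} → ℝ)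

/-- The projections between the manifolds `ℝ^{H_α}`. -/
def stdRes {α β : Λ} (h : α ≤ β) : stdStage p β ⟶ stdStage p α :=
  linear (ContinuousLinearMap.pi fun i => ContinuousLinearMap.proj ⟨i.1, i.2.trans h⟩)

/-- The projections `ℝ^n → ℝ^{H_α}`. -/
def stdProj (α : Λ) : vec (Fin n → ℝ) ⟶ stdStage p α :=
  linear (ContinuousLinearMap.pi fun i => ContinuousLinearMap.proj i.1)

/-- The extension of a family of coordinates by zero. -/
def stdExtend {α : Λ} (v : {i // p i ≤ α} → ℝ) (i : Fin n) : ℝ := if h : p i ≤ α then v ⟨i, h⟩ else 0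

theorem stdProj_extend {α : Λ} (v : {i // p i ≤ α} → ℝ) :
    (stdProj p α).toFun (stdExtend p v) = v := by
  funext i
  exact dif_pos i.2

/-- The multifibered manifold given by `ℝ^n` and its coordinate projections to `ℝ^{H_α}`. -/
def std : MultifiberedMfd Λ where
  stage := stdStage p
  res := stdRes p
  res_refl _ := rfl
  res_comp _ _ := rfl
  res_submersion {α β} h := isSurjSubmersion_linear _ fun v => by
    refine ⟨(stdProj p β).toFun (stdExtend p v), ?_⟩
    exact stdProj_extend p v
  total := vec (Fin n → ℝ)
  proj := stdProj p
  proj_res _ := rfl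
  proj_submersion α := isSurjSubmersion_linear _ fun v => ⟨stdExtend p v, stdProj_extend p v⟩
  isLimit x hx := by
    refine ⟨fun i => x (p i) ⟨i, le_rfl⟩, fun α => ?_, fun y hy => ?_⟩
    · funext i
      exact (congrFun (hx i.2) ⟨i, le_rfl⟩).symm
    · funext i
      exact congrFun (hy (p i)) ⟨i, le_rfl⟩
  adapted := ⟨n, p, fun x => ⟨centeredChart (vec (Fin n → ℝ)) x (.refl ℝ _),
    fun α => centeredChart (stdStage p α) ((stdProj p α).toFun x) (.refl ℝ _), trivial,
    sub_self (G := Fin n → ℝ) x, fun _ => ⟨fun _ _ => trivial, fun _ _ _ => rfl⟩⟩⟩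

/-- The `i`-th coordinate as a function on `ℝ^{H_α}`. -/
def stdCoord (α : Λ) (i : {i // p i ≤ α}) : stdStage p α ⟶ vec ℝ :=
  linear (ContinuousLinearMap.proj i)

theorem stdRes_coord {α β : Λ} (h : α ≤ β) (i : {i // p i ≤ α}) :
    stdRes p h ≫ stdCoord p α i = stdCoord p β ⟨i.1, i.2.trans h⟩ := rfl

/-- The manifold `ℝ^{H_α}` is a product of copies of `ℝ`. -/
def stdStageIsLimit (α : Λ) : IsLimit (Fan.mk (stdStage p α) (stdCoord p α)) :=
  Fan.IsLimit.mk _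
    (fun s => ⟨fun z i => (s.proj i).toFun z, contMDiff_pi_space.2 fun i => (s.proj i).contMDiff⟩)
    (fun _ _ => rfl) fun s m hm => by
      ext z
      funext i
      exact congr_toFun (hm i) z

/-- The coordinates as maps to the multifibered manifolds `i_{p i}(ℝ)`. -/
def stdToIncl (i : Fin n) : std p ⟶ (incl (p i)).obj (vec ℝ) :=
  inclHomEquiv (p i) (std p) (vec ℝ) (stdCoord p (p i) ⟨i, le_rfl⟩)

theorem fromStage_stdToIncl (i : Fin n) {γ : Λ} (h : p i ≤ γ) :
    (stdToIncl p i).app γ ≫ fromStage h (vec ℝ) = stdCoord p γ ⟨i, h⟩ :=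
  toStage_fromStage _ h

/-- The standard multifibered manifold is the product of the `i_{p i}(ℝ)`. -/
def stdIsLimit : IsLimit (Fan.mk (std p) (stdToIncl p)) :=
  Fan.IsLimit.mk _
    (fun s =>
      { app := fun α => Fan.IsLimit.lift (stdStageIsLimit p α) fun i =>
          (s.proj i.1).app α ≫ fromStage i.2 (vec ℝ)
        total := ⟨fun x i => (s.proj i).total.toFun x,
          contMDiff_pi_space.2 fun i => (s.proj i).total.contMDiff⟩
        app_res := fun {α β} h => by
          refine Fan.IsLimit.hom_ext (stdStageIsLimit p α) _ _ fun i => ?_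
          ext x
          have h1 := congr_toFun ((s.proj i.1).app_res h) x
          have h2 := congrArg (fromStage i.2 (vec ℝ)).toFun h1
          refine h2.trans ?_
          exact congr_toFun (toStage_fromStage (fun hδ => fromStage (hδ.trans h) (vec ℝ)) i.2)
            (((s.proj i.1).app β).toFun x)
        total_proj := fun α => by
          refine Fan.IsLimit.hom_ext (stdStageIsLimit p α) _ _ fun i => ?_
          ext x
          have h1 := congr_toFun ((s.proj i.1).total_proj α) x
          have h2 := congrArg (fromStage i.2 (vec ℝ)).toFun h1
          refine Eq.trans ?_ h2
          exact (congr_toFun (toStage_fromStage (fun _ => 𝟙 (vec ℝ)) i.2)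
            ((s.proj i.1).total.toFun x)).symm })
    (fun s i => by
      ext1 γ
      exact stage_ext fun h => by
        change _ ≫ (stdToIncl p i).app γ ≫ fromStage h (vec ℝ) = _
        rw [fromStage_stdToIncl]
        rfl)
    fun s m hm => by
      ext1 α
      refine Fan.IsLimit.hom_ext (stdStageIsLimit p α) _ _ fun i => ?_
      change m.app α ≫ stdCoord p α ⟨i.1, i.2⟩ = (s.proj i.1).app α ≫ fromStage i.2 (vec ℝ)
      rw [← hm i.1, ← fromStage_stdToIncl]
      rfl

/-- The i-th coordinate of ℝ^n is already visible in the stage p(i). -/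
theorem jointEmb_stdProj : JointEmb (std p).proj := by
  refine JointEmb.of_comp (E := fun _ : Fin n => vec ℝ) p
    (fun i => stdCoord p (p i) ⟨i, le_rfl⟩) ⟨.id, fun t v hv => ?_⟩
  funext i
  have h1 : stdProj p (p i) ≫ stdCoord p (p i) ⟨i, le_rfl⟩ =
    linear (ContinuousLinearMap.proj (R := ℝ) (φ := fun _ : Fin n => ℝ) i) := rfl
  have h2 := hv i
  change deriv (stdProj p (p i) ≫ stdCoord p (p i) ⟨i, le_rfl⟩) t v = 0 at h2
  rw [h1] at h2
  have h3 := deriv_linear (ContinuousLinearMap.proj (R := ℝ) (φ := fun _ : Fin n => ℝ) i) t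
  exact (congrArg (fun L : (Fin n → ℝ) →L[ℝ] ℝ => L v) h3).symm.trans h2

end std

/-- Multifibered manifolds are locally isomorphic to standard ones. -/
theorem exists_local_param (π : MultifiberedMfd Λ) : ∃ (n : ℕ) (p : Fin n → Λ), ∀ x : π.total,
    ∃ j : std p ⟶ π, openInc j ∧ IsOpenEmb j.total ∧ x ∈ Set.range j.total.toFun := by
  classical
  obtain ⟨n, p, H⟩ := π.adapted
  refine ⟨n, p, fun x => ?_⟩
  obtain ⟨h, k, hx, hx0, hk⟩ := H x
  have h0 : (0 : Fin n → ℝ) ∈ h.target := by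
    rw [← hx0]
    exact h.map_source hx
  obtain ⟨ε, hε, hball⟩ := Metric.isOpen_iff.1 h.open_target _ h0
  have hh : ∀ w : Fin n → ℝ, (∀ i, w i ∈ Metric.ball (0 : ℝ) ε) → w ∈ h.target := by
    intro w hw
    refine hball ?_
    rw [mem_ball_zero_iff, pi_norm_lt_iff hε]
    exact fun i => mem_ball_zero_iff.1 (hw i)
  -- One ε serves all stages: extending w by zero stays in the cube of ℝ^n, and the corresponding
  -- point of M projects to a point with coordinates w.
  have hk' : ∀ α, ∀ w : {i // p i ≤ α} → ℝ, (∀ i, w i ∈ Metric.ball (0 : ℝ) ε) →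
      w ∈ (k α).target := by
    intro α w hw
    have h1 : stdExtend p w ∈ h.target := hh _ fun i => by
      unfold stdExtend
      split_ifs with hi
      · exact hw _
      · exact Metric.mem_ball_self hε
    have h2 : h.symm (stdExtend p w) ∈ h.source := h.map_target h1
    have h3 : k α ((π.proj α).toFun (h.symm (stdExtend p w))) = w := by
      funext i
      rw [(hk α).2 _ h2 i]
      refine (congrFun (h.right_inv h1) i.1).trans ?_
      exact dif_pos i.2
    rw [← h3]
    exact (k α).map_source ((hk α).1 h2)
  -- The parametrizations commute with the projections because the rescaling acts on each coordinate
  -- separately; this is the reason for using cubes and not balls.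
  have htot : ∀ α v, (π.proj α).toFun ((cubeParam h hε hh).toFun v) =
      (cubeParam (k α) hε (hk' α)).toFun ((stdProj p α).toFun v) := by
    intro α v
    have h1 := cubeParam_mem_source h hε hh v
    refine (k α).injOn ((hk α).1 h1) (cubeParam_mem_source _ _ _ _) ?_
    refine Eq.trans ?_ (chart_cubeParam (k α) hε (hk' α) _).symm
    funext i
    refine ((hk α).2 _ h1 i).trans ?_
    rw [chart_cubeParam]
    rfl
  refine ⟨
    { app := fun α => cubeParam (k α) hε (hk' α)
      total := cubeParam h hε hh
      app_res := fun {α β} hαβ => ?_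
      total_proj := fun α => ?_ }, fun α => isOpenEmb_cubeParam (k α) hε (hk' α),
    isOpenEmb_cubeParam h hε hh, ?_⟩
  · ext v
    change (cubeParam (k α) hε (hk' α)).toFun ((stdRes p hαβ).toFun v) =
      (π.res hαβ).toFun ((cubeParam (k β) hε (hk' β)).toFun v)
    -- Every point of the stage β lifts to ℝ^n, so compatibility between stages follows from
    -- compatibility with the limit.
    rw [← stdProj_extend p v, ← htot β, ← comp_toFun _ (π.res hαβ), π.proj_res, htot α]
    rfl
  · ext v
    exact htot α v
  · refine ⟨(0 : Fin n → ℝ), ?_⟩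
    refine Eq.trans ?_ (h.left_inv hx)
    change h.invFun _ = h.invFun (h x)
    rw [hx0]
    congr 1
    funext i
    exact OpenPartialHomeomorph.univBall_apply_zero _ _

/-- The image of an open inclusion is determined by its images on the stages. -/
theorem mem_range_total {ρ π : MultifiberedMfd Λ} {j : ρ ⟶ π}
    (hj : ∀ α, Function.Injective (j.app α).toFun) (x : π.total)
    (hx : ∀ α, (π.proj α).toFun x ∈ Set.range (j.app α).toFun) : x ∈ Set.range j.total.toFun := by
  choose y hy using hx
  -- Injectivity on the stages makes the chosen preimages a thread of ρ.
  obtain ⟨z, hz, -⟩ := ρ.isLimit y fun {α β} h => hj α (by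
    have h1 := congr_toFun (j.app_res h) (y β)
    have h2 := congr_toFun (π.proj_res h) x
    simp only [comp_toFun] at h1 h2
    rw [h1, hy, h2, hy])
  refine ⟨z, π.point_ext fun α => ?_⟩
  have h1 := congr_toFun (j.total_proj α) z
  simp only [comp_toFun] at h1
  rw [h1, hz, hy]

variable [Finite Λ]

/-- The limit of a multifibered manifold is embedded in the product of its stages. -/
theorem jointEmb_proj (π : MultifiberedMfd Λ) : JointEmb π.proj := by
  obtain ⟨n, p, H⟩ := π.exists_local_param
  refine JointEmb.of_local fun x => ?_
  obtain ⟨j, hj, hjt, hx⟩ := H x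
  exact ⟨(std p).total, j.total, _, (std p).proj, j.app, hx, hjt, jointEmb_stdProj p, hj,
    j.total_proj, fun y hy => mem_range_total (fun α => (hj α).1) y hy⟩

end MultifiberedMfd

/-! ### Product charts -/

namespace Mfd

/-- The product of partial diffeomorphisms with values in Euclidean spaces. -/
def piPartialDiffeomorph {K : Type} [Fintype K] {X : K → Mfd} {I : K → Type} [∀ k, Fintype (I k)]
    (φ : ∀ k, PartialDiffeomorph 𝓘(ℝ, (X k).model) 𝓘(ℝ, I k → ℝ) (X k) (I k → ℝ) ∞)
    {J : Type} [Fintype J] (e : J ≃ Σ k, I k) :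
    PartialDiffeomorph 𝓘(ℝ, (pi X).model) 𝓘(ℝ, J → ℝ) (pi X) (J → ℝ) ∞ where
  toFun y j := φ (e j).1 (y (e j).1) (e j).2
  invFun v k := (φ k).symm fun i => v (e.symm ⟨k, i⟩)
  source := {y | ∀ k, y k ∈ (φ k).source}
  target := {v | ∀ k, (fun i => v (e.symm ⟨k, i⟩)) ∈ (φ k).target}
  map_source' y hy k := by
    have : (fun i => φ (e (e.symm ⟨k, i⟩)).1 (y (e (e.symm ⟨k, i⟩)).1) (e (e.symm ⟨k, i⟩)).2) =
        φ k (y k) := by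
      funext i
      rw [Equiv.apply_symm_apply]
    rw [this]
    exact (φ k).map_source (hy k)
  map_target' v hv k := (φ k).map_target (hv k)
  left_inv' y hy := by
    funext k
    have : (fun i => φ (e (e.symm ⟨k, i⟩)).1 (y (e (e.symm ⟨k, i⟩)).1) (e (e.symm ⟨k, i⟩)).2) =
        φ k (y k) := by
      funext i
      rw [Equiv.apply_symm_apply]
    dsimp only
    rw [this]
    exact (φ k).left_inv (hy k)
  right_inv' v hv := by
    funext j
    refine (congrFun ((φ (e j).1).right_inv (hv (e j).1)) (e j).2).trans ?_
    exact congrArg v (e.symm_apply_apply j)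
  open_source := by
    have h := isOpen_iInter_of_finite fun k =>
      (φ k).open_source.preimage (Mfd.continuous (piProj X k))
    convert h using 1
    ext y
    simp [piProj]
  open_target := by
    have h := isOpen_iInter_of_finite fun k => (φ k).open_target.preimage
      (f := fun (v : J → ℝ) i => v (e.symm ⟨k, i⟩)) (by fun_prop)
    convert h using 1
    ext y
    simp
  contMDiffOn_toFun := contMDiffOn_pi_space.2 fun j =>
    (contMDiffOn_pi_space.1 (φ (e j).1).contMDiffOn_toFun (e j).2).comp
      (f := (piProj X (e j).1).toFun) (piProj X (e j).1).contMDiff.contMDiffOn fun _ hy => hy _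
  contMDiffOn_invFun v hv := by
    refine ContMDiffAt.contMDiffWithinAt ((smoothAt_pi_iff (Z := vec (J → ℝ))).2 fun k => ?_)
    have h1 : ContDiff ℝ ∞ (fun (v : J → ℝ) i => v (e.symm ⟨k, i⟩)) := by fun_prop
    exact ContMDiffAt.comp (f := fun (v : J → ℝ) i => v (e.symm ⟨k, i⟩)) v
      ((φ k).contMDiffOn_invFun.contMDiffAt ((φ k).open_target.mem_nhds (hv k)))
      h1.contMDiff.contMDiffAt

end Mfd

namespace MultifiberedMfd

variable {Λ : Type u} [PartialOrder Λ]

open Mfd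

/-! ### Finite products of multifibered manifolds -/

section pi

variable {K : Type} [Fintype K] (π : K → MultifiberedMfd Λ)

open Classical in
-- The coordinates of the product are the disjoint union of those of the factors, and so are the
-- coordinates with index at most α; `s α` below is this second identification.
theorem pi_adapted : ∃ (n : ℕ) (p : Fin n → Λ), ∀ x : Mfd.pi fun k => (π k).total,
    ∃ (h : PartialDiffeomorph 𝓘(ℝ, (Mfd.pi fun k => (π k).total).model) 𝓘(ℝ, Fin n → ℝ)
        (Mfd.pi fun k => (π k).total) (Fin n → ℝ) ∞)
      (κ : ∀ α, PartialDiffeomorph 𝓘(ℝ, (Mfd.pi fun k => (π k).stage α).model)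
        𝓘(ℝ, {i // p i ≤ α} → ℝ) (Mfd.pi fun k => (π k).stage α) ({i // p i ≤ α} → ℝ) ∞),
      x ∈ h.source ∧ h x = 0 ∧
      ∀ α, Set.MapsTo (piMap fun k => (π k).proj α).toFun h.source (κ α).source ∧
        ∀ y ∈ h.source, ∀ i, κ α ((piMap fun k => (π k).proj α).toFun y) i = h y i := by
  choose n p H using fun k => (π k).adapted
  let e : Fin (Fintype.card (Σ k, Fin (n k))) ≃ Σ k, Fin (n k) := (Fintype.equivFin _).symm
  refine ⟨_, fun i => p (e i).1 (e i).2, fun x => ?_⟩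
  choose h κ hx hx0 hκ using fun k => H k (x k)
  let s (α : Λ) : {s : Σ k, Fin (n k) // p s.1 s.2 ≤ α} ≃ Σ k, {i // p k i ≤ α} :=
    ⟨fun s => ⟨s.1.1, s.1.2, s.2⟩, fun s => ⟨⟨s.1, s.2.1⟩, s.2.2⟩, fun _ => rfl, fun _ => rfl⟩
  refine ⟨piPartialDiffeomorph h e, fun α => piPartialDiffeomorph (fun k => κ k α)
    ((e.subtypeEquiv fun _ => Iff.rfl).trans (s α)), hx, ?_, fun α => ⟨?_, ?_⟩⟩
  · funext j
    exact congrFun (hx0 (e j).1) (e j).2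
  · exact fun y hy k => (hκ k α).1 (hy k)
  · exact fun y hy i => (hκ _ α).2 _ (hy _) ⟨(e i.1).2, i.2⟩

/-- The product of a finite family of multifibered manifolds. -/
def pi : MultifiberedMfd Λ where
  stage α := Mfd.pi fun k => (π k).stage α
  res h := piMap fun k => (π k).res h
  res_refl α := pi_hom_ext fun k => by
    simp only [(π k).res_refl, piMap, piLift_proj, Category.comp_id, Category.id_comp]
  res_comp h h' := pi_hom_ext fun k => by
    simp only [piMap, Category.assoc, piLift_proj, ← (π k).res_comp h h']
    rfl
  res_submersion h := isSurjSubmersion_piMap fun k => (π k).res_submersion h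
  total := Mfd.pi fun k => (π k).total
  proj α := piMap fun k => (π k).proj α
  proj_res h := pi_hom_ext fun k => by
    simp only [piMap, Category.assoc, piLift_proj, ← (π k).proj_res h]
    rfl
  proj_submersion α := isSurjSubmersion_piMap fun k => (π k).proj_submersion α
  isLimit x hx := by
    choose y hy hy' using fun k => (π k).isLimit (fun α => x α k) fun h => congrFun (hx h) k
    exact ⟨y, fun α => funext fun k => hy k α, fun z hz => funext fun k =>
      hy' k (z k) fun α => congrFun (hz α) k⟩
  adapted := pi_adapted π

/-- The projections of a product. -/
def piProj (k : K) : pi π ⟶ π k where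
  app α := Mfd.piProj (fun k => (π k).stage α) k
  total := Mfd.piProj (fun k => (π k).total) k
  app_res _ := rfl
  total_proj _ := rfl

/-- The product is a categorical product. -/
def piIsLimit : IsLimit (Fan.mk (pi π) (piProj π)) :=
  Fan.IsLimit.mk _
    (fun s =>
      { app := fun α => piLift fun k => (s.proj k).app α
        total := piLift fun k => (s.proj k).total
        app_res := fun h => pi_hom_ext fun k => (s.proj k).app_res h
        total_proj := fun α => pi_hom_ext fun k => (s.proj k).total_proj α })
    (fun _ _ => rfl)
    fun s m hm => by
      ext1 α
      exact pi_hom_ext fun k => congrArg (fun f => Hom.app f α) (hm k)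

end pi

instance : HasFiniteProducts (MultifiberedMfd Λ) :=
  ⟨fun n => ⟨fun F => by
    have : HasLimit (Discrete.functor (F.obj ∘ Discrete.mk)) := ⟨⟨_, piIsLimit fun k => F.obj ⟨k⟩⟩⟩
    exact hasLimit_of_iso (Discrete.natIsoFunctor (F := F)).symm⟩⟩

/-- Finite products of multifibered manifolds are formed stage by stage. -/
instance eval_preservesLimitsOfShape (K : Type) [Finite K] (α : Λ) :
    PreservesLimitsOfShape (Discrete K) (eval α) := by
  have := Fintype.ofFinite K
  refine @preservesLimitsOfShape_of_discrete _ _ _ _ _ (eval α) fun π => ?_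
  refine preservesLimit_of_preserves_limit_cone (piIsLimit π) ?_
  refine (isLimitMapConeFanMkEquiv (eval α) π (piProj π)).symm ?_
  exact Mfd.piIsLimit fun k => (π k).stage α

end MultifiberedMfd

/-! ### Product preserving functors and inductive systems -/

open MultifiberedMfd

namespace Mfd

/-- A functor to manifolds which preserves binary products preserves terminal objects. -/
def isTerminalObj {C : Type*} [Category C] (F : C ⥤ Mfd)
    [PreservesLimitsOfShape (Discrete WalkingPair) F] {T : C} (hT : IsTerminal T) :
    IsTerminal (F.obj T) := by
  -- T with two identities is the product T × T. Its image is then a product with equal projections,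
  -- so any two maps into F(T) coincide; a constant map exists because manifolds are non-empty.
  have h1 : IsLimit (BinaryFan.mk (𝟙 T) (𝟙 T)) :=
    BinaryFan.isLimitMk (fun s => s.fst) (fun _ => Category.comp_id _)
      (fun _ => hT.hom_ext _ _) fun _ _ _ _ => hT.hom_ext _ _
  have h2 := mapIsLimitOfPreservesOfIsLimit F _ _ h1
  refine IsTerminal.ofUniqueHom (fun Z => const Z (Classical.arbitrary _)) fun Z f => ?_
  obtain ⟨l, hl, hl'⟩ := BinaryFan.IsLimit.lift' h2 f (const Z (Classical.arbitrary _))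
  exact hl.symm.trans hl'

theorem preservesFiniteProducts {C : Type*} [Category C] [HasFiniteProducts C] (F : C ⥤ Mfd)
    [PreservesLimitsOfShape (Discrete WalkingPair) F] : PreservesFiniteProducts F := by
  have : PreservesLimit (Functor.empty.{0} C) F :=
    preservesLimit_of_preserves_limit_cone terminalIsTerminal
      ((isLimitMapConeEmptyConeEquiv F (⊤_ C)).symm (isTerminalObj F terminalIsTerminal))
  have : PreservesLimitsOfShape (Discrete.{0} PEmpty) F :=
    preservesLimitsOfShape_pempty_of_preservesTerminal F
  exact .of_preserves_binary_and_terminal F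

/-- The one-point manifold is terminal. -/
def ptIsTerminal : IsTerminal pt := IsTerminal.ofUniqueHom toPt fun _ _ => toPt_unique _ _

end Mfd

open Mfd

namespace PPBundleFunctor

variable {C : Type*} [Category C] [HasFiniteProducts C] {m : C ⥤ Mfd} {inc : MorphismProperty C}

instance (F : PPBundleFunctor m inc) : PreservesFiniteProducts F.total :=
  have := F.preservesProducts
  Mfd.preservesFiniteProducts F.total

/-- The image of a finite product is a product. -/
def mapIsLimit (F : PPBundleFunctor m inc) {K : Type} [Finite K] {X : K → C} {P : C}
    {f : ∀ k, P ⟶ X k} (h : IsLimit (Fan.mk P f)) :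
    IsLimit (Fan.mk (F.total.obj P) fun k => F.total.map (f k)) :=
  isLimitFanMkObjOfIsLimit F.total X f h

end PPBundleFunctor

namespace InductiveSystem

variable {Λ : Type u} [PartialOrder Λ] (μ : InductiveSystem Λ)

/-- The functor `G_α`. -/
abbrev fn (α : Λ) : Mfd ⥤ Mfd := (μ.obj α).total

/-- The transformation `μ^α_β`. -/
def trans {α β : Λ} (h : α ≤ β) : μ.fn α ⟶ μ.fn β := BundleFunctor.Hom.trans (μ.map (homOfLE h))

theorem trans_refl (α : Λ) : μ.trans (le_refl α) = 𝟙 _ :=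
  congrArg BundleFunctor.Hom.trans (μ.map_id α)

theorem trans_comp {α β γ : Λ} (h : α ≤ β) (h' : β ≤ γ) :
    μ.trans h ≫ μ.trans h' = μ.trans (h.trans h') :=
  (congrArg BundleFunctor.Hom.trans (μ.map_comp (homOfLE h) (homOfLE h'))).symm

theorem trans_comp_app {α β γ : Λ} (h : α ≤ β) (h' : β ≤ γ) (X : Mfd) :
    (μ.trans h).app X ≫ (μ.trans h').app X = (μ.trans (h.trans h')).app X :=
  congrArg (fun t => NatTrans.app t X) (μ.trans_comp h h')

theorem trans_proj {α β : Λ} (h : α ≤ β) (X : Mfd) :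
    (μ.trans h).app X ≫ (μ.obj β).proj.app X = (μ.obj α).proj.app X :=
  congrArg (fun t => NatTrans.app t X) (BundleFunctor.Hom.comp_proj (μ.map (homOfLE h)))

/-- Compatible families of maps to the manifolds `G_α(M_α)`. -/
def Compat (π : MultifiberedMfd Λ) {Z : Mfd} (f : ∀ α, Z ⟶ (μ.fn α).obj (π.stage α)) : Prop :=
  ∀ (α β : Λ) (h : α ≤ β), f β ≫ (μ.fn β).map (π.res h) = f α ≫ (μ.trans h).app (π.stage α)

variable {μ} in
theorem Compat.mem {π : MultifiberedMfd Λ} {Z : Mfd} {f : ∀ α, Z ⟶ (μ.fn α).obj (π.stage α)}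
    (hf : μ.Compat π f) (z : Z) : (fun α => (f α).toFun z) ∈ prodSet μ π :=
  fun α β h => congr_toFun (hf α β h) z

theorem compat_of_mem {π : MultifiberedMfd Λ} {Z : Mfd} {f : ∀ α, Z ⟶ (μ.fn α).obj (π.stage α)}
    (hf : ∀ z, (fun α => (f α).toFun z) ∈ prodSet μ π) : μ.Compat π f :=
  fun α β h => by
    ext z
    exact hf z α β h

/-! ### The standard case -/

section std

variable {n : ℕ} (p : Fin n → Λ)

/-- The manifold `∏_i G_{p i}(ℝ)`. -/
abbrev stdModel : Mfd := Mfd.pi fun i => (μ.fn (p i)).obj (vec ℝ)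

/-- `G_α(ℝ^{H_α})` is a product of copies of `G_α(ℝ)`. -/
def fnStdIsLimit (α β : Λ) : IsLimit (Fan.mk ((μ.fn β).obj (stdStage p α))
    fun i => (μ.fn β).map (stdCoord p α i)) :=
  (μ.obj β).mapIsLimit (stdStageIsLimit p α)

/-- The components of the parametrization of `∏_μ G_α(ℝ^{H_α})` by `∏_i G_{p i}(ℝ)`. -/
def stdParam (α : Λ) : μ.stdModel p ⟶ (μ.fn α).obj (stdStage p α) :=
  Fan.IsLimit.lift (μ.fnStdIsLimit p α α) fun i =>
    Mfd.piProj _ i.1 ≫ (μ.trans i.2).app (vec ℝ)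

theorem stdParam_coord (α : Λ) (i : {i // p i ≤ α}) :
    μ.stdParam p α ≫ (μ.fn α).map (stdCoord p α i) =
      Mfd.piProj _ i.1 ≫ (μ.trans i.2).app (vec ℝ) :=
  Fan.IsLimit.fac (μ.fnStdIsLimit p α α) _ i

theorem stdParam_coord_self (i : Fin n) :
    μ.stdParam p (p i) ≫ (μ.fn (p i)).map (stdCoord p (p i) ⟨i, le_rfl⟩) = Mfd.piProj _ i := by
  rw [stdParam_coord, trans_refl]
  exact Category.comp_id _

/-- The coordinate i of the component at p(i) is the projection to the i-th factor, since μ^α_α is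
the identity. -/
theorem jointEmb_stdParam [Finite Λ] : JointEmb (μ.stdParam p) :=
  JointEmb.of_comp (E := fun i => (μ.fn (p i)).obj (vec ℝ)) p
    (fun i => (μ.fn (p i)).map (stdCoord p (p i) ⟨i, le_rfl⟩)) (by
      simp only [stdParam_coord_self]
      exact JointEmb.piProj _)

theorem compat_stdParam : μ.Compat (std p) (μ.stdParam p) := by
  intro α β h
  refine Fan.IsLimit.hom_ext (μ.fnStdIsLimit p α β) _ _ fun i => ?_
  change (μ.stdParam p β ≫ (μ.fn β).map (stdRes p h)) ≫ (μ.fn β).map (stdCoord p α i) =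
    (μ.stdParam p α ≫ (μ.trans h).app (stdStage p α)) ≫ (μ.fn β).map (stdCoord p α i)
  rw [Category.assoc, ← Functor.map_comp, stdRes_coord, stdParam_coord, Category.assoc,
    ← NatTrans.naturality, ← Category.assoc, stdParam_coord, Category.assoc, trans_comp_app]

/-- The compatibility condition for p(i) ≤ α, read in the coordinate i, expresses that coordinate of
t_α through t_{p(i)}. So a compatible family is recovered from the coordinates i of its components
at p(i). -/
theorem eq_stdParam {t : ∀ α, (μ.fn α).obj (stdStage p α)} (ht : t ∈ prodSet μ (std p)) (α : Λ) :
    (μ.stdParam p α).toFun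
      (fun i => ((μ.fn (p i)).map (stdCoord p (p i) ⟨i, le_rfl⟩)).toFun (t (p i))) = t α := by
  refine (JointEmb.of_isLimit (μ.fnStdIsLimit p α α)).point_ext fun i => ?_
  refine (congr_toFun (μ.stdParam_coord p α i) _).trans ?_
  change ((μ.trans i.2).app (vec ℝ)).toFun (((μ.fn (p i)).map _).toFun (t (p i))) = _
  rw [← comp_toFun, NatTrans.naturality, comp_toFun]
  have h1 := ht (p i) α i.2
  refine (congrArg _ h1.symm).trans ?_
  change (((μ.fn α).map (stdRes p i.2)) ≫ (μ.fn α).map _).toFun (t α) = _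
  rw [← Functor.map_comp]
  rfl

theorem range_stdParam :
    (Set.range fun q α => (μ.stdParam p α).toFun q) = prodSet μ (std p) := by
  ext t
  constructor
  · rintro ⟨q, rfl⟩
    exact (μ.compat_stdParam p).mem q
  · exact fun ht => ⟨_, funext fun α => μ.eq_stdParam p ht α⟩

end std

end InductiveSystem

namespace PPBundleFunctor

variable {C : Type*} [Category C] {m : C ⥤ Mfd} {inc : MorphismProperty C}

@[ext]
theorem hom_ext {F G : PPBundleFunctor m inc} {a b : F ⟶ G}
    (h : BundleFunctor.Hom.trans a = BundleFunctor.Hom.trans b) : a = b :=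
  BundleFunctor.Hom.ext h

theorem isIso_of_isIso_trans {F G : PPBundleFunctor m inc} (a : F ⟶ G)
    [IsIso (BundleFunctor.Hom.trans a)] : IsIso a := by
  refine ⟨⟨inv (BundleFunctor.Hom.trans a), ?_⟩, ?_, ?_⟩
  · rw [IsIso.inv_comp_eq]
    exact (BundleFunctor.Hom.comp_proj a).symm
  · exact hom_ext (IsIso.hom_inv_id (BundleFunctor.Hom.trans a))
  · exact hom_ext (IsIso.inv_hom_id (BundleFunctor.Hom.trans a))

end PPBundleFunctor

/-! ### The universal property of T^μ and its functoriality in μ -/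

namespace IsT

variable {Λ : Type u} [PartialOrder Λ] {μ : InductiveSystem Λ} {T : PPBundleFunctorFM Λ}
  {ι : ∀ (π : MultifiberedMfd Λ) (α : Λ), T.total.obj π ⟶ (μ.fn α).obj (π.stage α)}

theorem jointEmb (h : IsT μ T ι) (π : MultifiberedMfd Λ) : JointEmb (ι π) :=
  ⟨h.isEmbedding π, h.immersion π⟩

theorem compat (h : IsT μ T ι) (π : MultifiberedMfd Λ) : μ.Compat π (ι π) :=
  InductiveSystem.compat_of_mem μ fun z => h.range_eq π ▸ ⟨z, rfl⟩

theorem exists_lift [Finite Λ] (h : IsT μ T ι) {π : MultifiberedMfd Λ} {Z : Mfd}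
    {f : ∀ α, Z ⟶ (μ.fn α).obj (π.stage α)} (hf : μ.Compat π f) :
    ∃ g : Z ⟶ T.total.obj π, ∀ α, g ≫ ι π α = f α :=
  (h.jointEmb π).exists_lift f fun z => (h.range_eq π).symm ▸ hf.mem z

/-- The map to `T(π)` given by a compatible family. -/
def lift [Finite Λ] (h : IsT μ T ι) {π : MultifiberedMfd Λ} {Z : Mfd}
    {f : ∀ α, Z ⟶ (μ.fn α).obj (π.stage α)} (hf : μ.Compat π f) : Z ⟶ T.total.obj π :=
  (h.exists_lift hf).choose

theorem lift_comp [Finite Λ] (h : IsT μ T ι) {π : MultifiberedMfd Λ} {Z : Mfd}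
    {f : ∀ α, Z ⟶ (μ.fn α).obj (π.stage α)} (hf : μ.Compat π f) (α : Λ) :
    h.lift hf ≫ ι π α = f α :=
  (h.exists_lift hf).choose_spec α

section map

variable {μ' : InductiveSystem Λ} {T' : PPBundleFunctorFM Λ}
  {ι' : ∀ (π : MultifiberedMfd Λ) (α : Λ), T'.total.obj π ⟶ (μ'.fn α).obj (π.stage α)}

/-- The components of a morphism of inductive systems. -/
abbrev comp (ν : μ ⟶ μ') (α : Λ) : μ.fn α ⟶ μ'.fn α := BundleFunctor.Hom.trans (ν.app α)

theorem comp_naturality (ν : μ ⟶ μ') {α β : Λ} (h : α ≤ β) (X : Mfd) :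
    (μ.trans h).app X ≫ (comp ν β).app X = (comp ν α).app X ≫ (μ'.trans h).app X :=
  congrArg (fun t => NatTrans.app (BundleFunctor.Hom.trans t) X) (ν.naturality (homOfLE h))

theorem compat_map (h : IsT μ T ι) (ν : μ ⟶ μ') (π : MultifiberedMfd Λ) :
    μ'.Compat π fun α => ι π α ≫ (comp ν α).app (π.stage α) := by
  intro α β hαβ
  rw [Category.assoc, ← NatTrans.naturality, ← Category.assoc, h.compat π α β hαβ,
    Category.assoc, Category.assoc, comp_naturality]

/-- The natural transformation induced by a morphism of inductive systems. -/
def map [Finite Λ] (h : IsT μ T ι) (h' : IsT μ' T' ι') (ν : μ ⟶ μ') : T ⟶ T' where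
  trans :=
    { app := fun π => h'.lift (h.compat_map ν π)
      naturality := fun π π' f => (h'.jointEmb π').hom_ext fun α => by
        rw [Category.assoc, Category.assoc, h'.map_eq, h'.lift_comp, ← Category.assoc,
          ← Category.assoc, h'.lift_comp, h.map_eq, Category.assoc, Category.assoc,
          NatTrans.naturality] }
  comp_proj := by
    ext1
    funext π
    refine π.jointEmb_proj.hom_ext fun α => ?_
    change (h'.lift (h.compat_map ν π) ≫ T'.proj.app π) ≫ _ = _
    have h1 := congrArg (fun t => NatTrans.app t (π.stage α))
      (BundleFunctor.Hom.comp_proj (ν.app α))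
    rw [Category.assoc, h'.proj_eq, ← Category.assoc, h'.lift_comp, Category.assoc, h.proj_eq]
    exact congrArg _ h1

theorem map_app [Finite Λ] (h : IsT μ T ι) (h' : IsT μ' T' ι') (ν : μ ⟶ μ') (π : MultifiberedMfd Λ) (α : Λ) :
    (BundleFunctor.Hom.trans (h.map h' ν)).app π ≫ ι' π α =
      ι π α ≫ (comp ν α).app (π.stage α) :=
  h'.lift_comp (h.compat_map ν π) α

/-- Isomorphic inductive systems have isomorphic functors `T^μ`. -/
def mapIso [Finite Λ] (h : IsT μ T ι) (h' : IsT μ' T' ι') (ν : μ ≅ μ') : T ≅ T' where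
  hom := h.map h' ν.hom
  inv := h'.map h ν.inv
  hom_inv_id := by
    ext π : 3
    refine (h.jointEmb π).hom_ext fun α => ?_
    change ((BundleFunctor.Hom.trans (h.map h' ν.hom)).app π ≫
      (BundleFunctor.Hom.trans (h'.map h ν.inv)).app π) ≫ _ = _
    rw [Category.assoc, map_app, ← Category.assoc, map_app, Category.assoc]
    have := congrArg (fun t => NatTrans.app (comp t α) (π.stage α)) ν.hom_inv_id
    exact (congrArg _ this).trans ((Category.comp_id _).trans (Category.id_comp _).symm)
  inv_hom_id := by
    ext π : 3
    refine (h'.jointEmb π).hom_ext fun α => ?_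
    change ((BundleFunctor.Hom.trans (h'.map h ν.inv)).app π ≫
      (BundleFunctor.Hom.trans (h.map h' ν.hom)).app π) ≫ _ = _
    rw [Category.assoc, map_app, ← Category.assoc, map_app, Category.assoc]
    have := congrArg (fun t => NatTrans.app (comp t α) (π.stage α)) ν.inv_hom_id
    exact (congrArg _ this).trans ((Category.comp_id _).trans (Category.id_comp _).symm)

end map

/-! ### The inductive system of `T^μ` -/

section incl

/-- The map `G_α(X) → G_γ(X_γ)`. -/
def toFnStage (μ : InductiveSystem Λ) (X : Mfd) (α γ : Λ) :
    (μ.fn α).obj X ⟶ (μ.fn γ).obj (inclStage α γ X) := by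
  classical
  -- Otherwise X_γ is a point, hence so is G_γ(X_γ), and the choice of the constant does not matter.
  exact if h : α ≤ γ then (μ.trans h).app X ≫ (μ.fn γ).map (toStage fun _ => 𝟙 X)
    else const _ (Classical.arbitrary _)

theorem toFnStage_of_le (X : Mfd) {α γ : Λ} (h : α ≤ γ) : toFnStage μ X α γ =
    (μ.trans h).app X ≫ (μ.fn γ).map (toStage fun _ => 𝟙 X) := dif_pos h

theorem fn_inclStage_hom_ext (X : Mfd) {α γ : Λ} (δ : Λ) (h : ¬ α ≤ γ) {Z : Mfd}
    (f g : Z ⟶ (μ.fn δ).obj (inclStage α γ X)) : f = g := by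
  have := (μ.obj δ).preservesProducts
  have h1 : IsTerminal (inclStage α γ X) := by
    rw [inclStage_neg h]
    exact ptIsTerminal
  exact (isTerminalObj (μ.fn δ) h1).hom_ext _ _

theorem compat_toFnStage (X : Mfd) (α : Λ) :
    μ.Compat (inclObj α X) (toFnStage μ X α) := by
  intro γ δ h
  by_cases hγ : α ≤ γ
  · change _ ≫ (μ.fn δ).map (toStage fun hγ => fromStage (hγ.trans h) X) = _
    rw [toFnStage_of_le X hγ, toFnStage_of_le X (hγ.trans h), Category.assoc, Category.assoc,
      NatTrans.naturality, ← Functor.map_comp, ← Category.assoc (g := (μ.trans h).app X),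
      InductiveSystem.trans_comp_app]
    congr 2
    exact stage_ext fun _ => by simp
  · exact fn_inclStage_hom_ext X δ hγ _ _

/-- The map `T(i_α(X)) → G_α(X)`. -/
def inclHom (ι : ∀ (π : MultifiberedMfd Λ) (α : Λ), T.total.obj π ⟶ (μ.fn α).obj (π.stage α))
    (X : Mfd) (α : Λ) : T.total.obj ((incl α).obj X) ⟶ (μ.fn α).obj X :=
  ι ((incl α).obj X) α ≫ (μ.fn α).map (fromStage le_rfl X)

/-- A compatible family over i_α(X) is determined by its component at α. For γ ≥ α the projection
X_γ → X_α is the identity of X, so compatibility computes x_γ from x_α; for other γ the component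
lies in a one-point manifold. -/
theorem inclHom_lift [Finite Λ] (h : IsT μ T ι) (X : Mfd) (α : Λ) :
    inclHom ι X α ≫ h.lift (compat_toFnStage X α) = 𝟙 _ := by
  refine (h.jointEmb _).hom_ext fun γ => ?_
  rw [Category.assoc, h.lift_comp, Category.id_comp]
  by_cases hγ : α ≤ γ
  · rw [toFnStage_of_le X hγ, inclHom, Category.assoc, ← Category.assoc ((μ.fn α).map _),
      NatTrans.naturality]
    have h1 := h.compat ((incl α).obj X) α γ hγ
    rw [Category.assoc, ← Category.assoc]
    refine (eq_whisker h1.symm _).trans ?_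
    rw [Category.assoc, ← Functor.map_comp, ← Functor.map_comp]
    refine (congrArg (fun t => ι ((incl α).obj X) γ ≫ (μ.fn γ).map t) ?_).trans
      ((congrArg _ ((μ.fn γ).map_id _)).trans (Category.comp_id _))
    refine stage_ext fun _ => ?_
    change (toStage (fun hδ => fromStage (hδ.trans hγ) X) ≫ fromStage le_rfl X ≫
      toStage fun _ => 𝟙 X) ≫ fromStage hγ X = 𝟙 (inclStage α γ X) ≫ fromStage hγ X
    simp
  · exact fn_inclStage_hom_ext X γ hγ _ _

theorem lift_inclHom [Finite Λ] (h : IsT μ T ι) (X : Mfd) (α : Λ) :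
    h.lift (compat_toFnStage X α) ≫ inclHom ι X α = 𝟙 _ := by
  rw [inclHom, ← Category.assoc, h.lift_comp, toFnStage_of_le X le_rfl, InductiveSystem.trans_refl,
    Category.assoc, ← Functor.map_comp, toStage_fromStage]
  exact (Category.id_comp _).trans ((μ.fn α).map_id X)

theorem inclHom_naturality (h : IsT μ T ι) {X Y : Mfd} (f : X ⟶ Y) (α : Λ) :
    T.total.map ((incl α).map f) ≫ inclHom ι Y α = inclHom ι X α ≫ (μ.fn α).map f := by
  rw [inclHom, inclHom, ← Category.assoc, h.map_eq, Category.assoc, Category.assoc,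
    ← Functor.map_comp, ← Functor.map_comp]
  congr 2
  exact toStage_fromStage _ _

theorem inclHom_inclTrans (h : IsT μ T ι) (X : Mfd) {α β : Λ} (hαβ : α ≤ β) :
    T.total.map ((inclTrans hαβ).app X) ≫ inclHom ι X β =
      inclHom ι X α ≫ (μ.trans hαβ).app X := by
  rw [inclHom, inclHom, ← Category.assoc, h.map_eq, Category.assoc, Category.assoc,
    NatTrans.naturality, ← Category.assoc (ι _ α)]
  have h1 := h.compat ((incl α).obj X) α β hαβ
  refine Eq.trans ?_ (eq_whisker h1 _)
  rw [Category.assoc, ← Functor.map_comp, ← Functor.map_comp]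
  congr 2
  change toStage (fun h => fromStage (hαβ.trans h) X) ≫ fromStage le_rfl X =
    toStage (fun hδ => fromStage (hδ.trans hαβ) X) ≫ fromStage le_rfl X
  simp

theorem inclHom_proj (h : IsT μ T ι) (X : Mfd) (α : Λ) :
    inclHom ι X α ≫ (μ.obj α).proj.app X = T.proj.app ((incl α).obj X) := by
  have h1 := (μ.obj α).proj.naturality (fromStage (le_refl α) X)
  have h2 := h.proj_eq ((incl α).obj X) α
  rw [inclHom, Category.assoc]
  refine (congrArg _ h1).trans ?_
  rw [← Category.assoc]
  refine (eq_whisker h2.symm _).trans ?_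
  rw [Category.assoc]
  refine (congrArg _ ?_).trans (Category.comp_id _)
  exact toStage_fromStage (fun _ => 𝟙 X) le_rfl

/-- The transformation from the inductive system of `T^μ` to `μ`. -/
def systemHom (h : IsT μ T ι) : inductiveSystemOf T ⟶ μ where
  app α :=
    { trans :=
        { app := fun X => inclHom ι X α
          naturality := fun _ _ f => h.inclHom_naturality f α }
      comp_proj := by
        ext1
        funext X
        exact h.inclHom_proj X α }
  naturality α β f := by
    ext X : 3
    exact h.inclHom_inclTrans X f.le

theorem isIso_systemHom [Finite Λ] (h : IsT μ T ι) : IsIso h.systemHom := by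
  have : ∀ α, IsIso (h.systemHom.app α) := fun α => by
    have : ∀ X, IsIso ((BundleFunctor.Hom.trans (h.systemHom.app α)).app X) := fun X =>
      ⟨h.lift (compat_toFnStage X α), h.inclHom_lift X α, h.lift_inclHom X α⟩
    have : IsIso (BundleFunctor.Hom.trans (h.systemHom.app α)) := NatIso.isIso_of_isIso_app _
    exact PPBundleFunctor.isIso_of_isIso_trans _
  exact NatIso.isIso_of_isIso_app _

/-- The inductive system of `T^μ` is isomorphic to `μ`. -/
def systemIso [Finite Λ] (h : IsT μ T ι) : inductiveSystemOf T ≅ μ :=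
  have := h.isIso_systemHom
  asIso h.systemHom

end incl

end IsT

namespace InductiveSystem

variable {Λ : Type u} [PartialOrder Λ] (μ : InductiveSystem Λ)

/-! ### Restriction to open multifibered submanifolds -/

theorem isOpenEmb_map {ρ π : MultifiberedMfd Λ} {j : ρ ⟶ π} (hj : openInc j) (α : Λ) :
    IsOpenEmb ((μ.fn α).map (j.app α)) := ((μ.obj α).locality (j.app α) (hj α)).1

theorem mem_range_map_iff {ρ π : MultifiberedMfd Λ} {j : ρ ⟶ π} (hj : openInc j) (α : Λ)
    (s : (μ.fn α).obj (π.stage α)) : s ∈ Set.range ((μ.fn α).map (j.app α)).toFun ↔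
      ((μ.obj α).proj.app (π.stage α)).toFun s ∈ Set.range (j.app α).toFun := by
  rw [((μ.obj α).locality (j.app α) (hj α)).2]
  exact Iff.rfl

variable {μ}

/-- The base points of a compatible family form a thread because the μ^α_β cover the identity, and
threads are points of the limit. -/
theorem exists_base {π : MultifiberedMfd Λ} {s : ∀ α, (μ.fn α).obj (π.stage α)}
    (hs : s ∈ prodSet μ π) : ∃ x : π.total, ∀ α,
      (π.proj α).toFun x = ((μ.obj α).proj.app (π.stage α)).toFun (s α) := by
  refine (π.isLimit _ fun {α β} h => ?_).exists
  refine (congr_toFun ((μ.obj β).proj.naturality (π.res h)) (s β)).symm.trans ?_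
  refine (congrArg _ (hs α β h)).trans ?_
  exact congr_toFun (μ.trans_proj h (π.stage α)) (s α)

/-- By naturality, G_β(j_α) carries each equation over ρ to the corresponding one over π, and it is
injective by locality. -/
theorem mem_prodSet_map_iff {ρ π : MultifiberedMfd Λ} {j : ρ ⟶ π} (hj : openInc j)
    (t : ∀ α, (μ.fn α).obj (ρ.stage α)) :
    (fun α => ((μ.fn α).map (j.app α)).toFun (t α)) ∈ prodSet μ π ↔ t ∈ prodSet μ ρ := by
  refine forall_congr' fun α => forall_congr' fun β => forall_congr' fun h => ?_
  have h1 : ((μ.fn β).map (π.res h)).toFun (((μ.fn β).map (j.app β)).toFun (t β)) =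
      ((μ.fn β).map (j.app α)).toFun (((μ.fn β).map (ρ.res h)).toFun (t β)) := by
    rw [← comp_toFun, ← comp_toFun, ← Functor.map_comp, ← Functor.map_comp, j.app_res]
  have h2 : ((μ.trans h).app (π.stage α)).toFun (((μ.fn α).map (j.app α)).toFun (t α)) =
      ((μ.fn β).map (j.app α)).toFun (((μ.trans h).app (ρ.stage α)).toFun (t α)) := by
    rw [← comp_toFun, ← comp_toFun, NatTrans.naturality]
  change _ = ((μ.trans h).app (π.stage α)).toFun _ ↔ _
  rw [h1, h2]
  exact ((μ.obj β).locality (j.app α) (hj α)).1.1.eq_iff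

theorem exists_restrict {ρ π : MultifiberedMfd Λ} {j : ρ ⟶ π} (hj : openInc j)
    {s : ∀ α, (μ.fn α).obj (π.stage α)} (hs : s ∈ prodSet μ π)
    (hr : ∀ α, s α ∈ Set.range ((μ.fn α).map (j.app α)).toFun) :
    ∃ t ∈ prodSet μ ρ, ∀ α, ((μ.fn α).map (j.app α)).toFun (t α) = s α := by
  choose t ht using hr
  exact ⟨t, (mem_prodSet_map_iff hj t).1 (by simpa only [ht] using hs), ht⟩

theorem mem_range_of_base {ρ π : MultifiberedMfd Λ} {j : ρ ⟶ π} (hj : openInc j)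
    {s : ∀ α, (μ.fn α).obj (π.stage α)} {x : π.total} (hx : x ∈ Set.range j.total.toFun)
    (hs : ∀ α, (π.proj α).toFun x = ((μ.obj α).proj.app (π.stage α)).toFun (s α)) (α : Λ) :
    s α ∈ Set.range ((μ.fn α).map (j.app α)).toFun := by
  obtain ⟨y, rfl⟩ := hx
  rw [mem_range_map_iff μ hj, ← hs]
  exact ⟨_, (congr_toFun (j.total_proj α) y).symm⟩

end InductiveSystem

/-! ### A bundle functor is determined by its inductive system -/

namespace MultifiberedMfd

variable {Λ : Type u} [PartialOrder Λ]

/-- The canonical map `π → i_α(M_α)`. -/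
def toIncl (π : MultifiberedMfd Λ) (α : Λ) : π ⟶ (incl α).obj (π.stage α) :=
  inclHomEquiv α π (π.stage α) (𝟙 _)

theorem toIncl_naturality {π π' : MultifiberedMfd Λ} (f : π ⟶ π') (α : Λ) :
    f ≫ π'.toIncl α = π.toIncl α ≫ (incl α).map (f.app α) := by
  ext1 γ
  refine stage_ext fun h => ?_
  change (f.app γ ≫ toStage fun h => π'.res h ≫ 𝟙 _) ≫ fromStage h _ =
    ((toStage fun h => π.res h ≫ 𝟙 _) ≫ toStage fun h => fromStage h _ ≫ f.app α) ≫ fromStage h _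
  simp [f.app_res]

/-- Both composites π → i_β(M_α) correspond under the adjunction to M_β → M_α. Applying F to this
identity gives the equations that define T^μ for μ = μ^F. -/
theorem toIncl_res (π : MultifiberedMfd Λ) {α β : Λ} (hαβ : α ≤ β) :
    π.toIncl β ≫ (incl β).map (π.res hαβ) = π.toIncl α ≫ (inclTrans hαβ).app (π.stage α) := by
  ext1 γ
  refine stage_ext fun h => ?_
  change ((toStage fun h => π.res h ≫ 𝟙 _) ≫ toStage fun h => fromStage h _ ≫ π.res hαβ) ≫
      fromStage h _ =
    ((toStage fun h => π.res h ≫ 𝟙 _) ≫ toStage fun h => fromStage (hαβ.trans h) _) ≫ fromStage h _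
  simp [π.res_comp]

theorem toIncl_stdCoord {n : ℕ} (p : Fin n → Λ) (i : Fin n) :
    (std p).toIncl (p i) ≫ (incl (p i)).map (stdCoord p (p i) ⟨i, le_rfl⟩) = stdToIncl p i := by
  ext1 γ
  refine stage_ext fun h => ?_
  change ((toStage fun h => (std p).res h ≫ 𝟙 _) ≫ toStage fun h => fromStage h _ ≫
    stdCoord p (p i) ⟨i, le_rfl⟩) ≫ fromStage h _ = (toStage fun h => (std p).res h ≫ _) ≫ _
  simp only [Category.comp_id, Category.assoc, toStage_fromStage]
  exact toStage_fromStage_assoc _ h _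

end MultifiberedMfd

namespace PPBundleFunctor

variable {Λ : Type u} [PartialOrder Λ] (F : PPBundleFunctorFM Λ)

/-- The maps `F(π) → F(i_α(M_α))`. -/
def emb (π : MultifiberedMfd Λ) (α : Λ) :
    F.total.obj π ⟶ ((inductiveSystemOf F).fn α).obj (π.stage α) :=
  F.total.map (π.toIncl α)

theorem emb_map {π π' : MultifiberedMfd Λ} (f : π ⟶ π') (α : Λ) :
    F.total.map f ≫ F.emb π' α = F.emb π α ≫ ((inductiveSystemOf F).fn α).map (f.app α) := by
  change F.total.map f ≫ F.total.map (π'.toIncl α) =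
    F.total.map _ ≫ F.total.map ((incl α).map (f.app α))
  rw [← Functor.map_comp, ← Functor.map_comp, toIncl_naturality]

theorem emb_proj (π : MultifiberedMfd Λ) (α : Λ) : F.proj.app π ≫ π.proj α =
    F.emb π α ≫ ((inductiveSystemOf F).obj α).proj.app (π.stage α) :=
  (F.proj.naturality (π.toIncl α)).symm

theorem compat_emb (π : MultifiberedMfd Λ) : (inductiveSystemOf F).Compat π (F.emb π) := by
  intro α β h
  change F.total.map _ ≫ F.total.map ((incl β).map (π.res h)) =
    F.total.map _ ≫ F.total.map ((inclTrans h).app (π.stage α))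
  rw [← Functor.map_comp, ← Functor.map_comp, toIncl_res]

section std

variable {n : ℕ} (p : Fin n → Λ)

theorem emb_std_coord (i : Fin n) : F.emb (std p) (p i) ≫
    ((inductiveSystemOf F).fn (p i)).map (stdCoord p (p i) ⟨i, le_rfl⟩) =
      F.total.map (stdToIncl p i) := by
  change F.total.map _ ≫ F.total.map ((incl (p i)).map _) = _
  rw [← Functor.map_comp, toIncl_stdCoord]

/-- The projections of the product F(std) → F(i_{p(i)}(ℝ)) factor through these maps. -/
theorem jointEmb_emb_std : JointEmb (F.emb (std p)) :=
  JointEmb.of_comp (E := fun i => ((inductiveSystemOf F).fn (p i)).obj (vec ℝ)) p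
    (fun i => ((inductiveSystemOf F).fn (p i)).map (stdCoord p (p i) ⟨i, le_rfl⟩)) (by
      simp only [emb_std_coord]
      exact JointEmb.of_isLimit (F.mapIsLimit (stdIsLimit p)))

theorem range_emb_std :
    (Set.range fun q α => (F.emb (std p) α).toFun q) = prodSet (inductiveSystemOf F) (std p) := by
  refine Set.Subset.antisymm ?_ fun t ht => ?_
  · rintro _ ⟨q, rfl⟩
    exact (F.compat_emb (std p)).mem q
  · let q (i : Fin n) : ((inductiveSystemOf F).fn (p i)).obj (vec ℝ) :=
      (((inductiveSystemOf F).fn (p i)).map (stdCoord p (p i) ⟨i, le_rfl⟩)).toFun (t (p i))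
    have hl := F.mapIsLimit (stdIsLimit p)
    -- Points are maps from the one-point manifold, so the universal property produces a point of
    -- F(std) with prescribed coordinates. It has image t because `eq_stdParam` determines both
    -- families by these coordinates.
    let l : pt ⟶ F.total.obj (std p) := Fan.IsLimit.lift hl fun i => const pt (q i)
    let z : F.total.obj (std p) := l.toFun PUnit.unit
    have hz : ∀ i, (F.total.map (stdToIncl p i)).toFun z = q i := fun i =>
      congr_toFun (Fan.IsLimit.fac hl (fun i => const pt (q i)) i) PUnit.unit
    refine ⟨z, funext fun α => ?_⟩
    refine (InductiveSystem.eq_stdParam _ p ((F.compat_emb (std p)).mem z) α).symm.trans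
      (Eq.trans ?_ (InductiveSystem.eq_stdParam _ p ht α))
    congr 1
    funext i
    exact (congr_toFun (F.emb_std_coord p i) z).trans (hz i)

end std

/-- The standard case is transported along local parametrizations. Locality of F and of the G_α says
that both sides, over the image of an open inclusion, are the images of the corresponding objects
for its source. -/
theorem isT_emb [Finite Λ] : IsT (inductiveSystemOf F) F F.emb := by
  have hr : ∀ {ρ π : MultifiberedMfd Λ} {j : ρ ⟶ π}, openInc j → ∀ s : F.total.obj π,
      (∀ α, (F.emb π α).toFun s ∈
        Set.range (((inductiveSystemOf F).fn α).map (j.app α)).toFun) →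
      s ∈ Set.range (F.total.map j).toFun := by
    intro ρ π j hj s hs
    rw [(F.locality j hj).2]
    refine mem_range_total (fun α => (hj α).1) _ fun α => ?_
    have h1 := (InductiveSystem.mem_range_map_iff _ hj α _).1 (hs α)
    rwa [← comp_toFun, ← emb_proj] at h1
  have hemb : ∀ π, JointEmb (F.emb π) := by
    intro π
    obtain ⟨n, p, H⟩ := π.exists_local_param
    refine JointEmb.of_local fun s => ?_
    obtain ⟨j, hj, hjt, hx⟩ := H ((F.proj.app π).toFun s)
    refine ⟨_, F.total.map j, _, F.emb (std p), _, ?_, (F.locality j hj).1, F.jointEmb_emb_std p,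
      InductiveSystem.isOpenEmb_map _ hj, F.emb_map j, hr hj⟩
    rw [(F.locality j hj).2]
    exact hx
  refine ⟨fun π => (hemb π).isEmbedding, fun π => (hemb π).immersion, fun π => ?_,
    F.emb_map, F.emb_proj⟩
  refine Set.Subset.antisymm ?_ fun s hs => ?_
  · rintro _ ⟨q, rfl⟩
    exact (F.compat_emb π).mem q
  · obtain ⟨x, hx⟩ := InductiveSystem.exists_base hs
    obtain ⟨n, p, H⟩ := π.exists_local_param
    obtain ⟨j, hj, -, hjx⟩ := H x
    obtain ⟨t, ht, hts⟩ := InductiveSystem.exists_restrict hj hs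
      (InductiveSystem.mem_range_of_base hj hjx hx)
    rw [← range_emb_std] at ht
    obtain ⟨u, rfl⟩ := ht
    refine ⟨(F.total.map j).toFun u, funext fun α => ?_⟩
    rw [← hts]
    exact congr_toFun (F.emb_map j α) u

end PPBundleFunctor

/-! ### Existence of `T^μ` -/

namespace InductiveSystem

variable {Λ : Type u} [PartialOrder Λ] (μ : InductiveSystem Λ)

/-- The projection `∏_i G_{p i}(ℝ) → ℝ^n`. -/
def stdModelProj {n : ℕ} (p : Fin n → Λ) : μ.stdModel p ⟶ (std p).total :=
  ⟨fun q i => ((μ.obj (p i)).proj.app (vec ℝ)).toFun (q i), contMDiff_pi_space.2 fun i =>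
    (Mfd.piProj (fun i => (μ.fn (p i)).obj (vec ℝ)) i ≫ (μ.obj (p i)).proj.app (vec ℝ)).contMDiff⟩

theorem isSurjSubmersion_stdModelProj {n : ℕ} (p : Fin n → Λ) :
    IsSurjSubmersion (μ.stdModelProj p) := by
  refine (isSurjSubmersion_iff _).2 ⟨fun x => ?_, fun q w => ?_⟩
  · choose q hq using fun i => ((μ.obj (p i)).fibered (vec ℝ)).1 (x i)
    exact ⟨q, funext hq⟩
  · choose v hv using fun i => ((isSurjSubmersion_iff _).1 ((μ.obj (p i)).fibered (vec ℝ))).2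
      (q i) (w i)
    refine ⟨v, funext fun i => ?_⟩
    let c : (std p).total ⟶ vec ℝ :=
      linear (ContinuousLinearMap.proj (R := ℝ) (φ := fun _ : Fin n => ℝ) i)
    have h1 := deriv_comp_apply (μ.stdModelProj p) c q v
    have h2 := deriv_comp_apply (Mfd.piProj (fun i => (μ.fn (p i)).obj (vec ℝ)) i)
      ((μ.obj (p i)).proj.app (vec ℝ)) q v
    have h3 : Mfd.deriv c ((μ.stdModelProj p).toFun q) = ContinuousLinearMap.proj i :=
      deriv_linear _ _
    rw [h3] at h1
    rw [deriv_piProj] at h2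
    exact h1.symm.trans (h2.trans (hv i))

theorem stdParam_proj {n : ℕ} (p : Fin n → Λ) (α : Λ) :
    μ.stdParam p α ≫ (μ.obj α).proj.app (stdStage p α) = μ.stdModelProj p ≫ (std p).proj α := by
  refine Fan.IsLimit.hom_ext (stdStageIsLimit p α) _ _ fun i => ?_
  change (μ.stdParam p α ≫ (μ.obj α).proj.app (stdStage p α)) ≫ stdCoord p α i =
    Mfd.piProj _ i.1 ≫ (μ.obj (p i.1)).proj.app (vec ℝ)
  have h1 := (μ.obj α).proj.naturality (stdCoord p α i)
  rw [Category.assoc]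
  refine (whisker_eq _ h1.symm).trans ?_
  rw [← Category.assoc, stdParam_coord, Category.assoc, trans_proj]

variable [Finite Λ]

/-- Around each compatible family, a local parametrization of π carries the standard solution set
onto a relatively open subset. Since n and p do not depend on the point, all the parametrizations
have the same domain, and the dimension is constant. -/
theorem exists_prodMfd (π : MultifiberedMfd Λ) :
    ∃ (N : Mfd) (ι : ∀ α, N ⟶ (μ.fn α).obj (π.stage α)), JointEmb ι ∧
      (Set.range fun t α => (ι α).toFun t) = prodSet μ π := by
  obtain ⟨n, p, H⟩ := π.exists_local_param
  have hmem : ∀ {j : std p ⟶ π}, openInc j → ∀ q,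
      (fun α => ((μ.fn α).map (j.app α)).toFun ((μ.stdParam p α).toFun q)) ∈ prodSet μ π :=
    fun hj q => (mem_prodSet_map_iff hj _).2 ((μ.compat_stdParam p).mem q)
  refine exists_submanifold (prodSet μ π) ?_ (μ.stdModel p) fun r hr => ?_
  · obtain ⟨j, hj, -, -⟩ := H (Classical.arbitrary _)
    exact ⟨_, hmem hj (Classical.arbitrary _)⟩
  · obtain ⟨x, hx⟩ := exists_base hr
    obtain ⟨j, hj, -, hjx⟩ := H x
    have hrange : ∀ s ∈ prodSet μ π,
        (∀ α, s α ∈ Set.range ((μ.fn α).map (j.app α)).toFun) → s ∈ Set.range fun q α =>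
          (μ.stdParam p α ≫ (μ.fn α).map (j.app α)).toFun q := by
      intro s hs hs'
      obtain ⟨t, ht, hts⟩ := exists_restrict hj hs hs'
      rw [← range_stdParam] at ht
      obtain ⟨q, rfl⟩ := ht
      exact ⟨q, funext hts⟩
    refine ⟨fun α => μ.stdParam p α ≫ (μ.fn α).map (j.app α),
      (μ.jointEmb_stdParam p).comp_openEmb (μ.isOpenEmb_map hj),
      hrange r hr (mem_range_of_base hj hjx hx),
      ⋂ α, (fun s => s α) ⁻¹' Set.range ((μ.fn α).map (j.app α)).toFun, ?_, ?_⟩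
    · exact isOpen_iInter_of_finite fun α =>
        (μ.isOpenEmb_map hj α).isOpen_range.preimage (continuous_apply α)
    · refine Set.Subset.antisymm ?_ fun s hs => hrange s hs.1 fun α => Set.mem_iInter.1 hs.2 α
      rintro _ ⟨q, rfl⟩
      exact ⟨hmem hj q, Set.mem_iInter.2 fun α => ⟨_, rfl⟩⟩

/-- The manifold `T^μ(π)`. -/
def prodMfd (π : MultifiberedMfd Λ) : Mfd := (μ.exists_prodMfd π).choose

/-- The maps `T^μ(π) → G_α(M_α)`. -/
def prodEmb (π : MultifiberedMfd Λ) (α : Λ) : μ.prodMfd π ⟶ (μ.fn α).obj (π.stage α) :=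
  (μ.exists_prodMfd π).choose_spec.choose α

theorem jointEmb_prodEmb (π : MultifiberedMfd Λ) : JointEmb (μ.prodEmb π) :=
  (μ.exists_prodMfd π).choose_spec.choose_spec.1

theorem range_prodEmb (π : MultifiberedMfd Λ) :
    (Set.range fun t α => (μ.prodEmb π α).toFun t) = prodSet μ π :=
  (μ.exists_prodMfd π).choose_spec.choose_spec.2

theorem compat_prodEmb (π : MultifiberedMfd Λ) : μ.Compat π (μ.prodEmb π) :=
  compat_of_mem μ fun z => μ.range_prodEmb π ▸ ⟨z, rfl⟩

variable {μ} in
theorem Compat.exists_lift {π : MultifiberedMfd Λ} {Z : Mfd}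
    {f : ∀ α, Z ⟶ (μ.fn α).obj (π.stage α)} (hf : μ.Compat π f) :
    ∃ g : Z ⟶ μ.prodMfd π, ∀ α, g ≫ μ.prodEmb π α = f α :=
  (μ.jointEmb_prodEmb π).exists_lift f fun z => (μ.range_prodEmb π).symm ▸ hf.mem z

theorem compat_map {π π' : MultifiberedMfd Λ} (f : π ⟶ π') :
    μ.Compat π' fun α => μ.prodEmb π α ≫ (μ.fn α).map (f.app α) := by
  intro α β h
  rw [Category.assoc, Category.assoc, NatTrans.naturality, ← Category.assoc _ ((μ.trans h).app _),
    ← μ.compat_prodEmb π α β h, Category.assoc, ← Functor.map_comp, ← Functor.map_comp, f.app_res]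

theorem exists_prodProj (π : MultifiberedMfd Λ) : ∃ g : μ.prodMfd π ⟶ π.total,
    ∀ α, g ≫ π.proj α = μ.prodEmb π α ≫ (μ.obj α).proj.app (π.stage α) := by
  refine π.jointEmb_proj.exists_lift _ fun z => ?_
  obtain ⟨x, hx⟩ := exists_base ((μ.compat_prodEmb π).mem z)
  exact ⟨x, funext hx⟩

/-- The functor `T^μ`. -/
abbrev prodFunctor : MultifiberedMfd Λ ⥤ Mfd where
  obj := μ.prodMfd
  map f := (μ.compat_map f).exists_lift.choose
  map_id π := (μ.jointEmb_prodEmb π).hom_ext fun α => by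
    rw [(μ.compat_map (𝟙 π)).exists_lift.choose_spec, id_app]
    exact (whisker_eq _ ((μ.fn α).map_id _)).trans
      ((Category.comp_id _).trans (Category.id_comp _).symm)
  map_comp {π π' π''} f g := (μ.jointEmb_prodEmb π'').hom_ext fun α => by
    rw [(μ.compat_map (f ≫ g)).exists_lift.choose_spec, Category.assoc,
      (μ.compat_map g).exists_lift.choose_spec, ← Category.assoc,
      (μ.compat_map f).exists_lift.choose_spec, comp_app, Functor.map_comp, Category.assoc]

theorem prodFunctor_map {π π' : MultifiberedMfd Λ} (f : π ⟶ π') (α : Λ) :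
    μ.prodFunctor.map f ≫ μ.prodEmb π' α = μ.prodEmb π α ≫ (μ.fn α).map (f.app α) :=
  (μ.compat_map f).exists_lift.choose_spec α

/-- The bundle projection of `T^μ`. -/
def prodProj : μ.prodFunctor ⟶ base Λ where
  app π := (μ.exists_prodProj π).choose
  naturality π π' f := π'.jointEmb_proj.hom_ext fun α => by
    have h1 := (μ.exists_prodProj π').choose_spec α
    have h2 := (μ.exists_prodProj π).choose_spec α
    change (μ.prodFunctor.map f ≫ _) ≫ _ = (_ ≫ f.total) ≫ _
    rw [Category.assoc, h1, Category.assoc, f.total_proj, ← Category.assoc, prodFunctor_map,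
      ← Category.assoc _ (π.proj α), h2, Category.assoc, Category.assoc]
    exact whisker_eq _ ((μ.obj α).proj.naturality (f.app α))

theorem prodProj_app (π : MultifiberedMfd Λ) (α : Λ) : μ.prodProj.app π ≫ π.proj α =
    μ.prodEmb π α ≫ (μ.obj α).proj.app (π.stage α) :=
  (μ.exists_prodProj π).choose_spec α

/-- Local form of the bundle projection: over the image of j it is modelled on the product of the
projections G_{p(i)}(ℝ) → ℝ. -/
theorem exists_prodParam {π : MultifiberedMfd Λ} {n : ℕ} {p : Fin n → Λ} {j : std p ⟶ π}
    (hj : openInc j) : ∃ c : μ.stdModel p ⟶ μ.prodMfd π,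
      (∀ α, c ≫ μ.prodEmb π α = μ.stdParam p α ≫ (μ.fn α).map (j.app α)) ∧
      c ≫ μ.prodProj.app π = μ.stdModelProj p ≫ j.total := by
  have hc : μ.Compat π fun α => μ.stdParam p α ≫ (μ.fn α).map (j.app α) :=
    compat_of_mem μ fun q => (mem_prodSet_map_iff hj _).2 ((μ.compat_stdParam p).mem q)
  obtain ⟨c, hc⟩ := hc.exists_lift
  refine ⟨c, hc, π.jointEmb_proj.hom_ext fun α => ?_⟩
  change (c ≫ μ.prodProj.app π) ≫ _ = _
  rw [Category.assoc, prodProj_app, ← Category.assoc, hc, Category.assoc, Category.assoc,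
    j.total_proj, ← Category.assoc _ ((std p).proj α), ← stdParam_proj]
  exact (whisker_eq _ ((μ.obj α).proj.naturality (j.app α))).trans (Category.assoc _ _ _).symm

theorem isSurjSubmersion_prodProj (π : MultifiberedMfd Λ) :
    IsSurjSubmersion (μ.prodProj.app π) := by
  obtain ⟨n, p, H⟩ := π.exists_local_param
  have hsub := (isSurjSubmersion_iff _).1 (μ.isSurjSubmersion_stdModelProj p)
  refine (isSurjSubmersion_iff _).2 ⟨fun x => ?_, fun t => ?_⟩
  · obtain ⟨j, hj, -, v, rfl⟩ := H x
    obtain ⟨c, -, hc⟩ := μ.exists_prodParam hj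
    obtain ⟨q, rfl⟩ := hsub.1 v
    exact ⟨c.toFun q, congr_toFun hc q⟩
  · have ht := (μ.compat_prodEmb π).mem t
    obtain ⟨x, hx⟩ := exists_base ht
    obtain ⟨j, hj, hjt, hjx⟩ := H x
    obtain ⟨c, hcι, hc⟩ := μ.exists_prodParam hj
    obtain ⟨s, hs, hst⟩ := exists_restrict hj ht (mem_range_of_base hj hjx hx)
    rw [← range_stdParam] at hs
    obtain ⟨q, rfl⟩ := hs
    obtain rfl : c.toFun q = t := (μ.jointEmb_prodEmb π).point_ext fun α =>
      (congr_toFun (hcι α) q).trans (hst α)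
    -- A tangent vector w of M is lifted through j, which is a local diffeomorphism, then through
    -- the standard projection, and pushed forward by c; no invertibility of c is needed.
    intro w
    obtain ⟨v, rfl⟩ := (hjt.deriv_bijective ((μ.stdModelProj p).toFun q)).2 w
    obtain ⟨u, rfl⟩ := hsub.2 q v
    refine ⟨Mfd.deriv c q u, ?_⟩
    refine (deriv_comp_apply c (μ.prodProj.app π) q u).symm.trans ?_
    rw [hc]
    exact deriv_comp_apply _ _ _ _

theorem prodFunctor_locality {ρ π : MultifiberedMfd Λ} {j : ρ ⟶ π} (hj : openInc j) :
    IsOpenEmb (μ.prodFunctor.map j) ∧ Set.range (μ.prodFunctor.map j).toFun =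
      (μ.prodProj.app π).toFun ⁻¹' Set.range j.total.toFun := by
  have hr : ∀ y : μ.prodMfd π,
      (∀ α, (μ.prodEmb π α).toFun y ∈ Set.range ((μ.fn α).map (j.app α)).toFun) →
      y ∈ Set.range (μ.prodFunctor.map j).toFun := by
    intro y hy
    obtain ⟨t, ht, hty⟩ := exists_restrict hj ((μ.compat_prodEmb π).mem y) hy
    rw [← range_prodEmb] at ht
    obtain ⟨s, rfl⟩ := ht
    exact ⟨s, (μ.jointEmb_prodEmb π).point_ext fun α =>
      (congr_toFun (μ.prodFunctor_map j α) s).trans (hty α)⟩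
  refine ⟨(μ.jointEmb_prodEmb ρ).isOpenEmb (ι' := μ.prodEmb π) (μ.isOpenEmb_map hj)
    (μ.prodFunctor_map j) hr, Set.Subset.antisymm ?_ fun y hy => hr y ?_⟩
  · rintro _ ⟨t, rfl⟩
    exact ⟨_, (congr_toFun (μ.prodProj.naturality j) t).symm⟩
  · exact mem_range_of_base hj hy fun α => congr_toFun (μ.prodProj_app π α) y

theorem preservesProducts_prodFunctor :
    PreservesLimitsOfShape (Discrete WalkingPair) μ.prodFunctor := by
  have hG : ∀ α, PreservesLimitsOfShape (Discrete WalkingPair) (μ.fn α) := fun α =>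
    (μ.obj α).preservesProducts
  refine ⟨fun {D} => ⟨fun {c} hc => ?_⟩⟩
  -- The case α = β lifts the components. The mixed case is needed because the compatibility
  -- equation for α ≤ β lives in G_β(M_α), where it is tested on the factors.
  have hl : ∀ α β, IsLimit ((eval α ⋙ μ.fn β).mapCone c) := fun α β => isLimitOfPreserves _ hc
  have H : ∀ s : Cone (D ⋙ μ.prodFunctor), ∃ l : s.pt ⟶ μ.prodMfd c.pt,
      ∀ k, l ≫ μ.prodFunctor.map (c.π.app k) = s.π.app k := by
    intro s
    let sα (α : Λ) : Cone (D ⋙ eval α ⋙ μ.fn α) :=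
      { pt := s.pt
        π :=
          { app := fun k => s.π.app k ≫ μ.prodEmb (D.obj k) α
            naturality := fun k k' f => by
              obtain rfl := Discrete.ext (Discrete.eq_of_hom f)
              obtain rfl : f = 𝟙 _ := Subsingleton.elim _ _
              simp } }
    have hs : ∀ α k, (hl α α).lift (sα α) ≫ (μ.fn α).map ((c.π.app k).app α) =
        s.π.app k ≫ μ.prodEmb (D.obj k) α := fun α k => (hl α α).fac (sα α) k
    have hcompat : μ.Compat c.pt fun α => (hl α α).lift (sα α) := by
      intro α β h
      refine (hl α β).hom_ext fun k => ?_
      have h1 : c.pt.res h ≫ (c.π.app k).app α = (c.π.app k).app β ≫ (D.obj k).res h :=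
        (c.π.app k).app_res h
      have h2 := (μ.trans h).naturality ((c.π.app k).app α)
      change ((hl β β).lift (sα β) ≫ (μ.fn β).map (c.pt.res h)) ≫
          (μ.fn β).map ((c.π.app k).app α) =
        ((hl α α).lift (sα α) ≫ (μ.trans h).app (c.pt.stage α)) ≫
          (μ.fn β).map ((c.π.app k).app α)
      rw [Category.assoc, ← Functor.map_comp, h1, Functor.map_comp, ← Category.assoc, hs,
        Category.assoc, μ.compat_prodEmb _ α β h, Category.assoc]
      refine Eq.trans ?_ (whisker_eq _ h2)
      rw [← Category.assoc, ← Category.assoc]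
      exact eq_whisker (hs α k).symm _
    obtain ⟨l, hl'⟩ := hcompat.exists_lift
    refine ⟨l, fun k => (μ.jointEmb_prodEmb _).hom_ext fun α => ?_⟩
    refine (Category.assoc _ _ _).trans ?_
    rw [prodFunctor_map, ← Category.assoc, hl', hs]
  choose l hl' using H
  refine ⟨⟨l, hl', fun s m hm => (μ.jointEmb_prodEmb _).hom_ext fun α =>
    (hl α α).hom_ext fun k => ?_⟩⟩
  have h1 : m ≫ μ.prodFunctor.map (c.π.app k) = l s ≫ μ.prodFunctor.map (c.π.app k) :=
    (hm k).trans (hl' s k).symm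
  have h2 : ∀ f : s.pt ⟶ μ.prodMfd c.pt,
      (f ≫ μ.prodEmb c.pt α) ≫ (μ.fn α).map ((c.π.app k).app α) =
        (f ≫ μ.prodFunctor.map (c.π.app k)) ≫ μ.prodEmb (D.obj k) α := fun f => by
    rw [Category.assoc, Category.assoc]
    exact whisker_eq _ (μ.prodFunctor_map (c.π.app k) α).symm
  exact (h2 m).trans ((eq_whisker h1 _).trans (h2 (l s)).symm)

/-- The product preserving bundle functor `T^μ`. -/
def prodBundleFunctor : PPBundleFunctorFM Λ where
  total := μ.prodFunctor
  proj := μ.prodProj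
  fibered := μ.isSurjSubmersion_prodProj
  locality _ hj := μ.prodFunctor_locality hj
  preservesProducts := μ.preservesProducts_prodFunctor

theorem isT_prodBundleFunctor : IsT μ μ.prodBundleFunctor μ.prodEmb where
  isEmbedding π := (μ.jointEmb_prodEmb π).isEmbedding
  immersion π := (μ.jointEmb_prodEmb π).immersion
  range_eq := μ.range_prodEmb
  map_eq := μ.prodFunctor_map
  proj_eq := μ.prodProj_app

end InductiveSystem

/-! ### The bijection -/

section

variable {Λ : Type u} [PartialOrder Λ]

/-- A natural transformation of bundle functors induces a morphism of inductive systems. -/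
def inductiveSystemOfMap {F F' : PPBundleFunctorFM Λ} (a : F ⟶ F') :
    inductiveSystemOf F ⟶ inductiveSystemOf F' where
  app α :=
    { trans := Functor.whiskerLeft (incl α) (BundleFunctor.Hom.trans a)
      comp_proj := by
        ext1
        funext X
        exact congrArg (fun t => NatTrans.app t ((incl α).obj X)) (BundleFunctor.Hom.comp_proj a) }
  naturality α β f := by
    ext X : 3
    exact (BundleFunctor.Hom.trans a).naturality ((inclTrans f.le).app X)

/-- A natural equivalence of bundle functors induces an equivalence of inductive systems. -/
def inductiveSystemOfIso {F F' : PPBundleFunctorFM Λ} (e : F ≅ F') :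
    inductiveSystemOf F ≅ inductiveSystemOf F' where
  hom := inductiveSystemOfMap e.hom
  inv := inductiveSystemOfMap e.inv
  hom_inv_id := by
    ext α : 2
    ext X : 3
    exact congrArg (fun t => NatTrans.app (BundleFunctor.Hom.trans t) ((incl α).obj X))
      e.hom_inv_id
  inv_hom_id := by
    ext α : 2
    ext X : 3
    exact congrArg (fun t => NatTrans.app (BundleFunctor.Hom.trans t) ((incl α).obj X))
      e.inv_hom_id

end

end

theorem proposition3p4 {Λ : Type*} [PartialOrder Λ] [Finite Λ] :
    ∃ Φ : Quotient (isIsomorphicSetoid (PPBundleFunctorFM Λ)) ≃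
        Quotient (isIsomorphicSetoid (InductiveSystem Λ)),
      (∀ F : PPBundleFunctorFM Λ,
        Φ (Quotient.mk _ F) = Quotient.mk _ (inductiveSystemOf F)) ∧
      ∀ μ : InductiveSystem Λ,
        (∃ (T : PPBundleFunctorFM Λ) (ι : _), IsT μ T ι) ∧
        ∀ (T : PPBundleFunctorFM Λ) (ι : _), IsT μ T ι →
          Φ.symm (Quotient.mk _ μ) = Quotient.mk _ T := by
  let φ : Quotient (isIsomorphicSetoid (PPBundleFunctorFM Λ)) →
      Quotient (isIsomorphicSetoid (InductiveSystem Λ)) :=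
    Quotient.map inductiveSystemOf fun F F' ⟨e⟩ => ⟨inductiveSystemOfIso e⟩
  have hT : ∀ (μ : InductiveSystem Λ) (T : PPBundleFunctorFM Λ) (ι : _), IsT μ T ι →
      φ (Quotient.mk _ T) = Quotient.mk _ μ :=
    fun μ T ι h => Quotient.sound ⟨h.systemIso⟩
  have hφ : Function.Bijective φ := by
    constructor
    · rintro ⟨F⟩ ⟨F'⟩ h
      obtain ⟨e⟩ := Quotient.exact h
      -- F and F' are copies of the functors T built from their own inductive systems, so an
      -- equivalence of the systems induces one of the functors.
      exact Quotient.sound ⟨F.isT_emb.mapIso F'.isT_emb e⟩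
    · rintro ⟨μ⟩
      exact ⟨_, hT μ _ _ μ.isT_prodBundleFunctor⟩
  refine ⟨Equiv.ofBijective φ hφ, fun F => rfl, fun μ =>
    ⟨⟨_, _, μ.isT_prodBundleFunctor⟩, fun T ι h => ?_⟩⟩
  rw [Equiv.symm_apply_eq]
  exact (hT μ T ι h).symm
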